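/- All C*-algebras below are complex, $\otimes$ denotes the spatial (minimal) tensor product of C*-algebras and $\odot$ the algebraic tensor product. A separable compact quantum group is a pair $G=(\mathcal A,\Delta)$ of a separable unital C*-algebra $\mathcal A$ and a unital $*$-homomorphism $\Delta:\mathcal A\to\mathcal A\otimes\mathcal A$ (the coproduct) such that $(\Delta\otimes\iota)\circ\Delta=(\iota\otimes\Delta)\circ\Delta$ and the sets $\{(b\otimes 1)\Delta(c):b,c\in\mathcal A\}$ and $\{(1\otimes b)\Delta(c):b,c\in\mathcal A\}$ both span dense subspaces of $\mathcal A\otimes\mathcal A$. A pair $K=(\mathcal A',\Delta')$ of a unital C*-algebra $\mathcal A'$ and a unital $*$-homomorphism $\Delta':\mathcal A'\to\mathcal A'\otimes\mathcal A'$ is a compact quantum subgroup of $G$ through $\pi$ if $\pi:\mathcal A\to\mathcal A'$ is a surjective unital $*$-homomorphism with $(\pi\otimes\pi)\circ\Delta=\Delta'\circ\pi$. For a closed two-sided ideal $\mathcal I$ of $\mathcal A$, let $\mathcal I\otimes\mathcal A$ and $\mathcal A\otimes\mathcal I$ denote the closed linear spans in $\mathcal A\otimes\mathcal A$ of $\{i\otimes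 a: i\in\mathcal I,\ a\in\mathcal A\}$ and $\{a\otimes i: a\in\mathcal A,\ i\in\mathcal I\}$; $\mathcal I$ is a closed coideal if $\Delta(\mathcal I)\subseteq\mathcal I\otimes\mathcal A+\mathcal A\otimes\mathcal I$. A C*-algebra $\mathcal A'$ is nuclear if for every C*-algebra $\mathcal B$ there is only one C*-norm on $\mathcal A'\odot\mathcal B$. **Theorem.** Let $G=(\mathcal A,\Delta)$ be a separable compact quantum group. (1) Let $\mathcal I$ be a closed two-sided ideal of $\mathcal A$ which is a closed coideal, and let $q:\mathcal A\to\mathcal A/\mathcal I$ be the quotient map. Then there is a unique unital $*$-homomorphism $\Delta^{\mathcal I}:\mathcal A/\mathcal I\to\mathcal A/\mathcal I\otimes\mathcal A/\mathcal I$ such that $(\mathcal A/\mathcal I,\Delta^{\mathcal I})$ is a compact quantum subgroup of $G$ through $q$; moreover $(\mathcal A/\mathcal I,\Delta^{\mathcal I})$ is itself a separable compact quantum group. (2) Conversely, let $K=(\mathcal A',\Delta')$ be a compact quantum subgroup of $G$ through $\pi:\mathcal A\to\mathcal A'$ with $\mathcal A'$ nuclear. Then the closed ideal $\mathcal I=\ker\pi$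 is a closed coideal, and $K$ is of the form (1): there is a unital $*$-homomorphism $\Delta^{\mathcal I}$ making $(\mathcal A/\mathcal I,\Delta^{\mathcal I})$ a compact quantum subgroup of $G$ through the quotient map $q$, together with a $*$-isomorphism $e:\mathcal A/\mathcal I\to\mathcal A'$ such that $e\circ q=\pi$ and $(e\otimes e)\circ\Delta^{\mathcal I}=\Delta'\circ e$. -/

import Mathlib

open scoped TensorProduct
open UniformSpace

universe u

set_option linter.unusedSectionVars false

noncomputable section

namespace CompactQuantum

/-! ### C*-seminorms and the associated completions -/

/-- A C*-seminorm on a unital `*`-algebra over `ℂ`. -/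
structure CStarSeminorm (X : Type u) [Ring X] [StarRing X] [Algebra ℂ X]
    extends Seminorm ℂ X where
  mul_le' : ∀ x y : X, toFun (x * y) ≤ toFun x * toFun y
  star_mul_self' : ∀ x : X, toFun (star x * x) = toFun x ^ 2

namespace CStarSeminorm

variable {X : Type u} [Ring X] [StarRing X] [Algebra ℂ X] [StarModule ℂ X]

/-- The algebra `X`, regarded as a seminormed algebra by means of `p`. -/
def Pre (_p : CStarSeminorm X) : Type u := X

variable (p : CStarSeminorm X)

instance : Ring p.Pre := inferInstanceAs (Ring X)
instance : StarRing p.Pre := inferInstanceAs (StarRing X)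
instance : Algebra ℂ p.Pre := inferInstanceAs (Algebra ℂ X)
instance : StarModule ℂ p.Pre := inferInstanceAs (StarModule ℂ X)

/-- The identity map from `X` to `p.Pre`. -/
def toPre : X →⋆ₐ[ℂ] p.Pre := StarAlgHom.id ℂ X

instance : SeminormedRing p.Pre :=
  { (inferInstance : Ring p.Pre),
    (p.toSeminorm.toAddGroupSeminorm.toSeminormedAddCommGroup : SeminormedAddCommGroup X) with
    norm_mul_le := p.mul_le' }

theorem norm_toPre (x : X) : ‖p.toPre x‖ = p.toSeminorm x := rfl

theorem toPre_surjective : Function.Surjective p.toPre := fun x => ⟨x, rfl⟩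

instance : NormedAlgebra ℂ p.Pre :=
  { (inferInstance : Algebra ℂ p.Pre) with
    norm_smul_le := fun c x => (p.toSeminorm.smul' c x).le }

theorem norm_star_mul_self_pre (x : p.Pre) : ‖star x * x‖ = ‖x‖ ^ 2 := p.star_mul_self' x

theorem norm_le_norm_star_pre (x : p.Pre) : ‖x‖ ≤ ‖star x‖ := by
  rcases (norm_nonneg x).eq_or_lt with h | h
  · rw [← h]; exact norm_nonneg _
  · have h1 := p.norm_star_mul_self_pre x
    have h2 := norm_mul_le (star x) x
    rw [h1, sq] at h2
    exact le_of_mul_le_mul_right h2 h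

theorem norm_star_pre (x : p.Pre) : ‖star x‖ = ‖x‖ :=
  le_antisymm (by simpa using p.norm_le_norm_star_pre (star x)) (p.norm_le_norm_star_pre x)

/-- The Hausdorff completion of `X` with respect to the C*-seminorm `p`. -/
def Compl : Type u := Completion p.Pre

instance : NormedRing p.Compl := inferInstanceAs (NormedRing (Completion p.Pre))
instance : CompleteSpace p.Compl := inferInstanceAs (CompleteSpace (Completion p.Pre))
instance : NormedAlgebra ℂ p.Compl :=
  { (inferInstance : Algebra ℂ (Completion p.Pre)) with
    norm_smul_le := fun c x => norm_smul_le (α := ℂ) (β := Completion p.Pre) c x }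

/-- The canonical map from `p.Pre` to the completion. -/
def coePre (x : p.Pre) : p.Compl := (x : Completion p.Pre)

theorem norm_coePre (x : p.Pre) : ‖p.coePre x‖ = ‖x‖ := Completion.norm_coe x
theorem isometry_coePre : Isometry p.coePre := Completion.coe_isometry
theorem continuous_coePre : Continuous p.coePre := p.isometry_coePre.continuous
theorem coePre_add (x y : p.Pre) : p.coePre (x + y) = p.coePre x + p.coePre y :=
  Completion.coe_add x y
theorem coePre_mul (x y : p.Pre) : p.coePre (x * y) = p.coePre x * p.coePre y :=
  Completion.coe_mul x y
theorem coePre_one : p.coePre 1 = 1 := rfl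
theorem coePre_zero : p.coePre 0 = 0 := rfl
theorem coePre_smul (c : ℂ) (x : p.Pre) : p.coePre (c • x) = c • p.coePre x :=
  Completion.coe_smul c x
theorem denseRange_coePre : DenseRange p.coePre := Completion.denseRange_coe

theorem isometry_star_pre : Isometry (star : p.Pre → p.Pre) :=
  Isometry.of_dist_eq fun x y => by
    rw [dist_eq_norm, dist_eq_norm, ← star_sub, p.norm_star_pre]

instance : Star p.Compl where
  star := Completion.map (star : p.Pre → p.Pre)

theorem continuous_star_compl : Continuous (star : p.Compl → p.Compl) :=
  Completion.continuous_map

theorem star_coePre (x : p.Pre) : star (p.coePre x) = p.coePre (star x) :=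
  Completion.map_coe p.isometry_star_pre.uniformContinuous x

instance : StarRing p.Compl where
  star_involutive x := by
    refine p.denseRange_coePre.induction_on (p := fun x => star (star x) = x) x
      (isClosed_eq (p.continuous_star_compl.comp p.continuous_star_compl) continuous_id) ?_
    intro a
    rw [star_coePre, star_coePre, star_star]
  star_mul x y := by
    refine p.denseRange_coePre.induction_on₂ (p := fun x y => star (x * y) = star y * star x)
      (isClosed_eq (p.continuous_star_compl.comp continuous_mul)
        ((p.continuous_star_compl.comp continuous_snd).mul
          (p.continuous_star_compl.comp continuous_fst))) ?_ x y
    intro a b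
    rw [← coePre_mul, star_coePre, star_coePre, star_coePre, star_mul, coePre_mul]
  star_add x y := by
    refine p.denseRange_coePre.induction_on₂ (p := fun x y => star (x + y) = star x + star y)
      (isClosed_eq (p.continuous_star_compl.comp continuous_add)
        ((p.continuous_star_compl.comp continuous_fst).add
          (p.continuous_star_compl.comp continuous_snd))) ?_ x y
    intro a b
    rw [← coePre_add, star_coePre, star_coePre, star_coePre, star_add, coePre_add]

/-- The completion of a unital `*`-algebra with respect to a C*-seminorm is a C*-algebra. -/
instance : CStarAlgebra p.Compl where
  norm_mul_self_le x := by
    refine p.denseRange_coePre.induction_on (p := fun x => ‖x‖ * ‖x‖ ≤ ‖star x * x‖) x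
      (isClosed_le (continuous_norm.mul continuous_norm)
        ((p.continuous_star_compl.mul continuous_id).norm)) ?_
    intro a
    rw [star_coePre, ← coePre_mul, norm_coePre, norm_coePre, p.norm_star_mul_self_pre, sq]
  star_smul c x := by
    refine p.denseRange_coePre.induction_on (p := fun x => star (c • x) = star c • star x) x
      (isClosed_eq (p.continuous_star_compl.comp (continuous_const_smul c))
        (p.continuous_star_compl.const_smul (star c))) ?_
    intro a
    rw [← coePre_smul, star_coePre, star_coePre, star_smul, coePre_smul]

/-- The canonical `*`-homomorphism from `X` to its completion. -/
def ι : X →⋆ₐ[ℂ] p.Compl where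
  toFun x := p.coePre (p.toPre x)
  map_one' := rfl
  map_mul' x y := by rw [map_mul, coePre_mul]
  map_zero' := rfl
  map_add' x y := by rw [map_add, coePre_add]
  commutes' c := by
    rw [Algebra.algebraMap_eq_smul_one, map_smul, coePre_smul, map_one, coePre_one,
      Algebra.algebraMap_eq_smul_one]
  map_star' x := by rw [map_star, star_coePre]

theorem norm_ι (x : X) : ‖p.ι x‖ = p.toSeminorm x := p.norm_coePre _

theorem denseRange_ι : DenseRange p.ι := p.denseRange_coePre

variable {D : Type*} [CStarAlgebra D]

/-- A `*`-homomorphism out of `X`, regarded as a ring homomorphism out of `p.Pre`. -/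
def preHom (f : X →⋆ₐ[ℂ] D) : p.Pre →+* D :=
  ((f : X →ₐ[ℂ] D) : X →+* D)

theorem preHom_toPre (f : X →⋆ₐ[ℂ] D) (x : X) : p.preHom f (p.toPre x) = f x := rfl

theorem continuous_preHom (f : X →⋆ₐ[ℂ] D) (hf : ∀ x, ‖f x‖ ≤ p.toSeminorm x) :
    Continuous (p.preHom f) :=
  AddMonoidHomClass.continuous_of_bound (p.preHom f) 1
    (fun x => by rw [one_mul]; exact hf x)

/-- The extension to the completion, as a ring homomorphism. -/
def liftRing (f : X →⋆ₐ[ℂ] D) (hf : ∀ x, ‖f x‖ ≤ p.toSeminorm x) : p.Compl →+* D :=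
  Completion.extensionHom (p.preHom f) (p.continuous_preHom f hf)

theorem liftRing_ι (f : X →⋆ₐ[ℂ] D) (hf : ∀ x, ‖f x‖ ≤ p.toSeminorm x) (x : X) :
    p.liftRing f hf (p.ι x) = f x :=
  Completion.extensionHom_coe (p.preHom f) (p.continuous_preHom f hf) (p.toPre x)

theorem continuous_liftRing (f : X →⋆ₐ[ℂ] D) (hf : ∀ x, ‖f x‖ ≤ p.toSeminorm x) :
    Continuous (p.liftRing f hf) :=
  Completion.continuous_extension

/-- A `*`-homomorphism into a C*-algebra that is dominated by `p` extends to the completion. -/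
def lift (f : X →⋆ₐ[ℂ] D) (hf : ∀ x, ‖f x‖ ≤ p.toSeminorm x) : p.Compl →⋆ₐ[ℂ] D :=
  { p.liftRing f hf with
    commutes' := fun c => by
      have h := p.liftRing_ι f hf (algebraMap ℂ X c)
      rw [AlgHomClass.commutes p.ι, AlgHomClass.commutes f] at h
      exact h
    map_star' := fun x => by
      refine p.denseRange_ι.induction_on
        (p := fun x => p.liftRing f hf (star x) = star (p.liftRing f hf x)) x
        (isClosed_eq ((p.continuous_liftRing f hf).comp p.continuous_star_compl)
          (continuous_star.comp (p.continuous_liftRing f hf))) ?_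
      intro a
      rw [← map_star, liftRing_ι, liftRing_ι, map_star] }

theorem lift_ι (f : X →⋆ₐ[ℂ] D) (hf : ∀ x, ‖f x‖ ≤ p.toSeminorm x) (x : X) :
    p.lift f hf (p.ι x) = f x :=
  p.liftRing_ι f hf x

end CStarSeminorm

/-- `*`-homomorphisms between C*-algebras are continuous. -/
theorem continuous_starAlgHom {A B : Type*} [CStarAlgebra A] [CStarAlgebra B]
    (f : A →⋆ₐ[ℂ] B) : Continuous f :=
  AddMonoidHomClass.continuous_of_bound f 1
    (fun x => by rw [one_mul]; exact NonUnitalStarAlgHom.norm_apply_le f x)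

namespace CStarSeminorm

variable {X : Type u} [Ring X] [StarRing X] [Algebra ℂ X] [StarModule ℂ X]

/-- The supremum of a pointwise bounded family of operator norms `‖θ i x‖`, where each `θ i` is a
`*`-homomorphism into a C*-algebra. -/
def ofFamily {I : Type*} {D : I → Type*} [∀ i, CStarAlgebra (D i)]
    (θ : ∀ i, X →⋆ₐ[ℂ] D i) (hθ : ∀ x, BddAbove (Set.range fun i => ‖θ i x‖)) :
    CStarSeminorm X where
  toFun x := ⨆ i, ‖θ i x‖
  map_zero' := by simp
  add_le' x y := by
    refine Real.iSup_le (fun i => ?_) (add_nonneg (Real.iSup_nonneg fun i => norm_nonneg _)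
      (Real.iSup_nonneg fun i => norm_nonneg _))
    rw [map_add]
    exact (norm_add_le _ _).trans (add_le_add (le_ciSup (hθ x) i) (le_ciSup (hθ y) i))
  neg' x := by simp
  smul' c x := by
    simp only [map_smul, norm_smul]
    exact (Real.mul_iSup_of_nonneg (norm_nonneg c) _).symm
  mul_le' x y := by
    refine Real.iSup_le (fun i => ?_) (mul_nonneg (Real.iSup_nonneg fun i => norm_nonneg _)
      (Real.iSup_nonneg fun i => norm_nonneg _))
    rw [map_mul]
    exact (norm_mul_le _ _).trans (mul_le_mul (le_ciSup (hθ x) i) (le_ciSup (hθ y) i)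
      (norm_nonneg _) (Real.iSup_nonneg fun i => norm_nonneg _))
  star_mul_self' x := by
    have h0 : 0 ≤ ⨆ i, ‖θ i x‖ := Real.iSup_nonneg fun i => norm_nonneg _
    have h1 : 0 ≤ ⨆ i, ‖θ i (star x * x)‖ := Real.iSup_nonneg fun i => norm_nonneg _
    have key : ∀ i, ‖θ i (star x * x)‖ = ‖θ i x‖ ^ 2 := fun i => by
      rw [map_mul, map_star, CStarRing.norm_star_mul_self, sq]
    apply le_antisymm
    · refine Real.iSup_le (fun i => ?_) (sq_nonneg _)
      rw [key]
      exact pow_le_pow_left₀ (norm_nonneg _) (le_ciSup (hθ x) i) 2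
    · rw [← Real.sqrt_le_sqrt_iff h1, Real.sqrt_sq h0]
      refine Real.iSup_le (fun i => ?_) (Real.sqrt_nonneg _)
      apply Real.le_sqrt_of_sq_le
      rw [← key]
      exact le_ciSup (hθ (star x * x)) i

section

variable {I : Type*} {D : I → Type*} [∀ i, CStarAlgebra (D i)]
    (θ : ∀ i, X →⋆ₐ[ℂ] D i) (hθ : ∀ x, BddAbove (Set.range fun i => ‖θ i x‖))

theorem le_ofFamily (i : I) (x : X) : ‖θ i x‖ ≤ (ofFamily θ hθ).toSeminorm x :=
  le_ciSup (hθ x) i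

theorem ofFamily_le {x : X} {C : ℝ} (hC : 0 ≤ C) (h : ∀ i, ‖θ i x‖ ≤ C) :
    (ofFamily θ hθ).toSeminorm x ≤ C :=
  Real.iSup_le h hC

end

/-- If `p` is the supremum of the norms of a family, then the extensions of the members of the
family to the completion determine the norm of the completion. -/
theorem norm_le_of_family (p : CStarSeminorm X) {I : Type*} {D : I → Type*}
    [∀ i, CStarAlgebra (D i)] (θ : ∀ i, X →⋆ₐ[ℂ] D i) (hθ : ∀ i x, ‖θ i x‖ ≤ p.toSeminorm x)
    (hp : ∀ (x : X) (C : ℝ), 0 ≤ C → (∀ i, ‖θ i x‖ ≤ C) → p.toSeminorm x ≤ C)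
    {z : p.Compl} {C : ℝ} (hC : 0 ≤ C) (h : ∀ i, ‖p.lift (θ i) (hθ i) z‖ ≤ C) : ‖z‖ ≤ C := by
  refine le_of_forall_pos_le_add fun ε hε => ?_
  obtain ⟨x, hx⟩ := p.denseRange_ι.exists_dist_lt z (half_pos hε)
  rw [dist_eq_norm] at hx
  have h1 : ‖p.ι x‖ ≤ C + ε / 2 := by
    rw [norm_ι]
    refine hp x _ (by positivity) fun i => ?_
    rw [← p.lift_ι (θ i) (hθ i) x]
    have h2 : ‖p.lift (θ i) (hθ i) (z - p.ι x)‖ ≤ ε / 2 :=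
      (NonUnitalStarAlgHom.norm_apply_le (p.lift (θ i) (hθ i)) _).trans hx.le
    rw [map_sub, norm_sub_rev] at h2
    have h3 := norm_le_norm_add_norm_sub' (p.lift (θ i) (hθ i) (p.ι x)) (p.lift (θ i) (hθ i) z)
    linarith [h i]
  have h3 := norm_le_norm_add_norm_sub' z (p.ι x)
  linarith

end CStarSeminorm

/-! ### Hilbert space tensor products and tensor products of representations -/

section Hilbert

variable (H K L : Type u)
  [NormedAddCommGroup H] [InnerProductSpace ℂ H]
  [NormedAddCommGroup K] [InnerProductSpace ℂ K]
  [NormedAddCommGroup L] [InnerProductSpace ℂ L]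

/-- The Hilbert space tensor product: the completion of the algebraic tensor product with respect
to the inner product `⟪x ⊗ y, x' ⊗ y'⟫ = ⟪x, x'⟫ ⟪y, y'⟫`. -/
def HilbertTensor : Type u := Completion (H ⊗[ℂ] K)

instance : NormedAddCommGroup (HilbertTensor H K) :=
  inferInstanceAs (NormedAddCommGroup (Completion (H ⊗[ℂ] K)))
instance : InnerProductSpace ℂ (HilbertTensor H K) :=
  inferInstanceAs (InnerProductSpace ℂ (Completion (H ⊗[ℂ] K)))
instance : CompleteSpace (HilbertTensor H K) :=
  inferInstanceAs (CompleteSpace (Completion (H ⊗[ℂ] K)))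

/-- The isometric inclusion of the algebraic tensor product. -/
def hemb : (H ⊗[ℂ] K) →ₗᵢ[ℂ] HilbertTensor H K :=
  (Completion.toComplₗᵢ : (H ⊗[ℂ] K) →ₗᵢ[ℂ] Completion (H ⊗[ℂ] K))

theorem denseRange_hemb : DenseRange (hemb H K) := Completion.denseRange_coe

variable {H K L}

/-- Elementary tensors in the Hilbert space tensor product. -/
def htmul (x : H) (y : K) : HilbertTensor H K := hemb H K (x ⊗ₜ[ℂ] y)

theorem htmul_add_left (x x' : H) (y : K) : htmul (x + x') y = htmul x y + htmul x' y := by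
  rw [htmul, TensorProduct.add_tmul, map_add]; rfl

theorem htmul_add_right (x : H) (y y' : K) : htmul x (y + y') = htmul x y + htmul x y' := by
  rw [htmul, TensorProduct.tmul_add, map_add]; rfl

theorem htmul_smul_left (c : ℂ) (x : H) (y : K) : htmul (c • x) y = c • htmul x y := by
  rw [htmul, ← TensorProduct.smul_tmul', map_smul]; rfl

theorem htmul_smul_right (c : ℂ) (x : H) (y : K) : htmul x (c • y) = c • htmul x y := by
  rw [htmul, TensorProduct.tmul_smul, map_smul]; rfl

theorem inner_htmul (x x' : H) (y y' : K) :
    inner ℂ (htmul x y) (htmul x' y') = inner ℂ x x' * inner ℂ y y' := by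
  rw [htmul, htmul, LinearIsometry.inner_map_map, TensorProduct.inner_tmul]

theorem hilbert_ext {E : Type*} [NormedAddCommGroup E] [NormedSpace ℂ E]
    {S T : HilbertTensor H K →L[ℂ] E}
    (h : ∀ (x : H) (y : K), S (htmul x y) = T (htmul x y)) : S = T := by
  ext z
  refine (denseRange_hemb H K).induction_on (p := fun z => S z = T z) z
    (isClosed_eq S.continuous T.continuous) ?_
  intro a
  induction a using TensorProduct.induction_on with
  | zero => rw [map_zero, map_zero, map_zero]
  | tmul x y => exact h x y
  | add a b ha hb => rw [map_add, map_add, map_add, ha, hb]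

theorem hilbert_inner_ext {S T : HilbertTensor H K →L[ℂ] HilbertTensor H K}
    (h : ∀ (x x' : H) (y y' : K),
      inner ℂ (S (htmul x y)) (htmul x' y') = inner ℂ (T (htmul x y)) (htmul x' y')) : S = T := by
  refine hilbert_ext fun x y => ?_
  have : innerSL ℂ (S (htmul x y)) = innerSL ℂ (T (htmul x y)) :=
    hilbert_ext fun x' y' => h x x' y y'
  exact innerSL_inj.mp this

variable (K) in
/-- The operator `S ⊗ 1`. -/
def opLeft (S : H →L[ℂ] H) : HilbertTensor H K →L[ℂ] HilbertTensor H K :=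
  (S.rTensor K).completion

variable (H) in
/-- The operator `1 ⊗ T`. -/
def opRight (T : K →L[ℂ] K) : HilbertTensor H K →L[ℂ] HilbertTensor H K :=
  (T.lTensor H).completion

theorem opLeft_htmul (S : H →L[ℂ] H) (x : H) (y : K) :
    opLeft K S (htmul x y) = htmul (S x) y :=
  ContinuousLinearMap.completion_apply_coe (S.rTensor K) _

theorem opRight_htmul (T : K →L[ℂ] K) (x : H) (y : K) :
    opRight H T (htmul x y) = htmul x (T y) :=
  ContinuousLinearMap.completion_apply_coe (T.lTensor H) _

variable (K) in
/-- The amplification `S ↦ S ⊗ 1`, as a `*`-homomorphism. -/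
def opLeftHom [CompleteSpace H] :
    (H →L[ℂ] H) →⋆ₐ[ℂ] (HilbertTensor H K →L[ℂ] HilbertTensor H K) where
  toFun S := opLeft K S
  map_one' := hilbert_ext fun x y => by simp [opLeft_htmul]
  map_mul' S T := hilbert_ext fun x y => by simp [opLeft_htmul]
  map_zero' := hilbert_ext fun x y => by
    simpa [opLeft_htmul] using htmul_smul_left (0 : ℂ) (0 : H) y
  map_add' S T := hilbert_ext fun x y => by simp [opLeft_htmul, htmul_add_left]
  commutes' c := hilbert_ext fun x y => by
    simp [Algebra.algebraMap_eq_smul_one, opLeft_htmul, htmul_smul_left]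
  map_star' S := hilbert_inner_ext fun x x' y y' => by
    simp [ContinuousLinearMap.star_eq_adjoint, ContinuousLinearMap.adjoint_inner_left,
      opLeft_htmul, inner_htmul]

variable (H) in
/-- The amplification `T ↦ 1 ⊗ T`, as a `*`-homomorphism. -/
def opRightHom [CompleteSpace K] :
    (K →L[ℂ] K) →⋆ₐ[ℂ] (HilbertTensor H K →L[ℂ] HilbertTensor H K) where
  toFun T := opRight H T
  map_one' := hilbert_ext fun x y => by simp [opRight_htmul]
  map_mul' S T := hilbert_ext fun x y => by simp [opRight_htmul]
  map_zero' := hilbert_ext fun x y => by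
    simpa [opRight_htmul] using htmul_smul_right (0 : ℂ) x (0 : K)
  map_add' S T := hilbert_ext fun x y => by simp [opRight_htmul, htmul_add_right]
  commutes' c := hilbert_ext fun x y => by
    simp [Algebra.algebraMap_eq_smul_one, opRight_htmul, htmul_smul_right]
  map_star' S := hilbert_inner_ext fun x x' y y' => by
    simp [ContinuousLinearMap.star_eq_adjoint, ContinuousLinearMap.adjoint_inner_left,
      opRight_htmul, inner_htmul]

end Hilbert

/-- The C*-algebra of bounded operators on a Hilbert space. -/
def BddOp (H : Type u) [NormedAddCommGroup H] [InnerProductSpace ℂ H] [CompleteSpace H] : Type u :=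
  H →L[ℂ] H

section BddOp

variable {H K : Type u}
  [NormedAddCommGroup H] [InnerProductSpace ℂ H] [CompleteSpace H]
  [NormedAddCommGroup K] [InnerProductSpace ℂ K] [CompleteSpace K]

instance : CStarAlgebra (BddOp H) := inferInstanceAs (CStarAlgebra (H →L[ℂ] H))

/-- An element of `BddOp H` as a continuous linear map. -/
def BddOp.toCLM (T : BddOp H) : H →L[ℂ] H := T

theorem BddOp.mul_toCLM (S T : BddOp H) (x : H) : (S * T).toCLM x = S.toCLM (T.toCLM x) := rfl

theorem BddOp.norm_toCLM (T : BddOp H) : ‖T.toCLM‖ = ‖T‖ := rfl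

variable (K) in
/-- The amplification `S ↦ S ⊗ 1`. -/
def ampLeft : BddOp H →⋆ₐ[ℂ] BddOp (HilbertTensor H K) := opLeftHom (H := H) K

variable (H) in
/-- The amplification `T ↦ 1 ⊗ T`. -/
def ampRight : BddOp K →⋆ₐ[ℂ] BddOp (HilbertTensor H K) := opRightHom (K := K) H

theorem ampLeft_htmul (S : BddOp H) (x : H) (y : K) :
    (ampLeft K S).toCLM (htmul x y) = htmul (S.toCLM x) y := opLeft_htmul S x y

theorem ampRight_htmul (T : BddOp K) (x : H) (y : K) :
    (ampRight H T).toCLM (htmul x y) = htmul x (T.toCLM y) := opRight_htmul T x y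

theorem amp_commute (S : BddOp H) (T : BddOp K) :
    Commute (ampLeft K S) (ampRight H T) := by
  have : (ampLeft K S * ampRight H T).toCLM = (ampRight H T * ampLeft K S).toCLM :=
    hilbert_ext fun x y => by
      rw [BddOp.mul_toCLM, BddOp.mul_toCLM, ampLeft_htmul, ampRight_htmul, ampRight_htmul,
        ampLeft_htmul]
  exact this

end BddOp


section CommLift

variable {X Y D : Type*} [Ring X] [StarRing X] [Algebra ℂ X] [StarModule ℂ X]
  [Ring Y] [StarRing Y] [Algebra ℂ Y] [StarModule ℂ Y]
  [CStarAlgebra D]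

/-- The `*`-homomorphism `x ⊗ y ↦ f x * g y` on the algebraic tensor product that is determined by
two `*`-homomorphisms with commuting ranges. -/
def commLift (f : X →⋆ₐ[ℂ] D) (g : Y →⋆ₐ[ℂ] D) (h : ∀ x y, Commute (f x) (g y)) :
    X ⊗[ℂ] Y →⋆ₐ[ℂ] D :=
  { Algebra.TensorProduct.lift (f : X →ₐ[ℂ] D) (g : Y →ₐ[ℂ] D) h with
    map_star' := fun z => by
      change Algebra.TensorProduct.lift (f : X →ₐ[ℂ] D) (g : Y →ₐ[ℂ] D) h (star z) =
        star (Algebra.TensorProduct.lift (f : X →ₐ[ℂ] D) (g : Y →ₐ[ℂ] D) h z)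
      induction z using TensorProduct.induction_on with
      | zero => simp
      | tmul x y =>
        have := h (star x) (star y)
        simp only [TensorProduct.star_tmul, Algebra.TensorProduct.lift_tmul, StarAlgHom.coe_toAlgHom,
          star_mul, ← map_star]
        exact this
      | add a b ha hb => rw [star_add, map_add, map_add, star_add, ha, hb] }

theorem commLift_tmul (f : X →⋆ₐ[ℂ] D) (g : Y →⋆ₐ[ℂ] D) (h : ∀ x y, Commute (f x) (g y))
    (x : X) (y : Y) : commLift f g h (x ⊗ₜ[ℂ] y) = f x * g y :=
  Algebra.TensorProduct.lift_tmul (f : X →ₐ[ℂ] D) (g : Y →ₐ[ℂ] D) h x y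

/-- Two `*`-homomorphisms on an algebraic tensor product that agree on elementary tensors agree. -/
theorem tensor_starHom_ext {f g : X ⊗[ℂ] Y →⋆ₐ[ℂ] D}
    (h : ∀ x y, f (x ⊗ₜ[ℂ] y) = g (x ⊗ₜ[ℂ] y)) : f = g := by
  ext z
  induction z using TensorProduct.induction_on with
  | zero => rw [map_zero, map_zero]
  | tmul x y => exact h x y
  | add a b ha hb => rw [map_add, map_add, ha, hb]

end CommLift

section TensorRep

variable {X Y : Type*} [Ring X] [StarRing X] [Algebra ℂ X] [StarModule ℂ X]
  [Ring Y] [StarRing Y] [Algebra ℂ Y] [StarModule ℂ Y]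
  {H K : Type u}
  [NormedAddCommGroup H] [InnerProductSpace ℂ H] [CompleteSpace H]
  [NormedAddCommGroup K] [InnerProductSpace ℂ K] [CompleteSpace K]

/-- The tensor product representation `x ⊗ y ↦ π x ⊗ ρ y` on the Hilbert space tensor product. -/
def tensorRep (π : X →⋆ₐ[ℂ] BddOp H) (ρ : Y →⋆ₐ[ℂ] BddOp K) :
    X ⊗[ℂ] Y →⋆ₐ[ℂ] BddOp (HilbertTensor H K) :=
  commLift ((ampLeft K).comp π) ((ampRight H).comp ρ) fun x y => amp_commute (π x) (ρ y)

theorem tensorRep_tmul (π : X →⋆ₐ[ℂ] BddOp H) (ρ : Y →⋆ₐ[ℂ] BddOp K) (x : X) (y : Y) :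
    tensorRep π ρ (x ⊗ₜ[ℂ] y) = ampLeft K (π x) * ampRight H (ρ y) :=
  commLift_tmul _ _ _ x y

theorem tensorRep_tmul_apply (π : X →⋆ₐ[ℂ] BddOp H) (ρ : Y →⋆ₐ[ℂ] BddOp K) (x : X) (y : Y)
    (ξ : H) (η : K) :
    (tensorRep π ρ (x ⊗ₜ[ℂ] y)).toCLM (htmul ξ η) = htmul ((π x).toCLM ξ) ((ρ y).toCLM η) := by
  rw [tensorRep_tmul, BddOp.mul_toCLM, ampRight_htmul, ampLeft_htmul]

end TensorRep

/-! ### The spatial tensor product of two C*-algebras -/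

/-- A unital `*`-representation of a unital C*-algebra on a Hilbert space. -/
structure HilbertRep (A : Type u) [CStarAlgebra A] : Type (u + 1) where
  space : Type u
  [normedAddCommGroup : NormedAddCommGroup space]
  [innerProductSpace : InnerProductSpace ℂ space]
  [completeSpace : CompleteSpace space]
  rep : A →⋆ₐ[ℂ] BddOp space

attribute [instance] HilbertRep.normedAddCommGroup HilbertRep.innerProductSpace
  HilbertRep.completeSpace

section AlgIncl

variable (X Y : Type*) [Ring X] [StarRing X] [Algebra ℂ X] [StarModule ℂ X]
  [Ring Y] [StarRing Y] [Algebra ℂ Y] [StarModule ℂ Y]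

/-- The embedding `x ↦ x ⊗ 1` into the algebraic tensor product. -/
def algInclLeft : X →⋆ₐ[ℂ] X ⊗[ℂ] Y :=
  { (Algebra.TensorProduct.includeLeft : X →ₐ[ℂ] X ⊗[ℂ] Y) with
    map_star' := fun x => by
      change star x ⊗ₜ[ℂ] (1 : Y) = star (x ⊗ₜ[ℂ] (1 : Y))
      rw [TensorProduct.star_tmul, star_one] }

/-- The embedding `y ↦ 1 ⊗ y` into the algebraic tensor product. -/
def algInclRight : Y →⋆ₐ[ℂ] X ⊗[ℂ] Y :=
  { (Algebra.TensorProduct.includeRight : Y →ₐ[ℂ] X ⊗[ℂ] Y) with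
    map_star' := fun y => by
      change (1 : X) ⊗ₜ[ℂ] star y = star ((1 : X) ⊗ₜ[ℂ] y)
      rw [TensorProduct.star_tmul, star_one] }

end AlgIncl

section Spatial

variable (A B C : Type u) [CStarAlgebra A] [CStarAlgebra B] [CStarAlgebra C]

theorem norm_tensorRep_tmul_le {X Y : Type*} [CStarAlgebra Y]
    [Ring X] [StarRing X] [Algebra ℂ X] [StarModule ℂ X] {H K : Type u}
    [NormedAddCommGroup H] [InnerProductSpace ℂ H] [CompleteSpace H]
    [NormedAddCommGroup K] [InnerProductSpace ℂ K] [CompleteSpace K]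
    (π : X →⋆ₐ[ℂ] BddOp H) (ρ : Y →⋆ₐ[ℂ] BddOp K) (x : X) (y : Y) :
    ‖tensorRep π ρ (x ⊗ₜ[ℂ] y)‖ ≤ ‖π x‖ * ‖y‖ := by
  rw [tensorRep_tmul]
  refine (norm_mul_le _ _).trans (mul_le_mul ?_ ?_ (norm_nonneg _) (norm_nonneg _))
  · exact NonUnitalStarAlgHom.norm_apply_le (ampLeft K) (π x)
  · exact NonUnitalStarAlgHom.norm_apply_le ((ampRight H).comp ρ) y

theorem bddAbove_tensorRep (x : A ⊗[ℂ] B) :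
    BddAbove (Set.range fun i : HilbertRep A × HilbertRep B => ‖tensorRep i.1.rep i.2.rep x‖) := by
  induction x using TensorProduct.induction_on with
  | zero =>
    refine ⟨0, ?_⟩
    rintro _ ⟨i, rfl⟩
    change ‖tensorRep i.1.rep i.2.rep 0‖ ≤ 0
    rw [map_zero, norm_zero]
  | tmul a b =>
    refine ⟨‖a‖ * ‖b‖, ?_⟩
    rintro _ ⟨i, rfl⟩
    refine (norm_tensorRep_tmul_le i.1.rep i.2.rep a b).trans
      (mul_le_mul_of_nonneg_right ?_ (norm_nonneg _))
    exact NonUnitalStarAlgHom.norm_apply_le i.1.rep a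
  | add x y hx hy =>
    obtain ⟨c, hc⟩ := hx
    obtain ⟨d, hd⟩ := hy
    refine ⟨c + d, ?_⟩
    rintro _ ⟨i, rfl⟩
    change ‖tensorRep i.1.rep i.2.rep (x + y)‖ ≤ c + d
    rw [map_add]
    exact (norm_add_le _ _).trans (add_le_add (hc ⟨i, rfl⟩) (hd ⟨i, rfl⟩))

/-- The spatial (minimal) C*-norm on the algebraic tensor product: the supremum of the operator
norms `‖(π ⊗ ρ) x‖` over all Hilbert space representations `π` of `A` and `ρ` of `B`. -/
def spatialNorm : CStarSeminorm (A ⊗[ℂ] B) :=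
  CStarSeminorm.ofFamily (fun i : HilbertRep A × HilbertRep B => tensorRep i.1.rep i.2.rep)
    (bddAbove_tensorRep A B)

/-- The spatial tensor product of two unital C*-algebras. -/
def SpatialTensor : Type u := (spatialNorm A B).Compl

instance : CStarAlgebra (SpatialTensor A B) :=
  inferInstanceAs (CStarAlgebra (spatialNorm A B).Compl)

/-- The canonical map from the algebraic to the spatial tensor product. -/
def ofAlg : A ⊗[ℂ] B →⋆ₐ[ℂ] SpatialTensor A B := (spatialNorm A B).ι

theorem denseRange_ofAlg : DenseRange (ofAlg A B) := (spatialNorm A B).denseRange_ι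

variable {A B C}

/-- Elementary tensors in the spatial tensor product. -/
def stmul (a : A) (b : B) : SpatialTensor A B := ofAlg A B (a ⊗ₜ[ℂ] b)

/-- The `*`-homomorphism out of the spatial tensor product that is determined by a
`*`-homomorphism out of the algebraic one which is contractive for the spatial norm. -/
def SpatialTensor.lift {D : Type*} [CStarAlgebra D] (f : A ⊗[ℂ] B →⋆ₐ[ℂ] D)
    (hf : ∀ x, ‖f x‖ ≤ (spatialNorm A B).toSeminorm x) : SpatialTensor A B →⋆ₐ[ℂ] D :=
  (spatialNorm A B).lift f hf

theorem SpatialTensor.lift_ofAlg {D : Type*} [CStarAlgebra D] (f : A ⊗[ℂ] B →⋆ₐ[ℂ] D)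
    (hf : ∀ x, ‖f x‖ ≤ (spatialNorm A B).toSeminorm x) (x : A ⊗[ℂ] B) :
    SpatialTensor.lift f hf (ofAlg A B x) = f x :=
  (spatialNorm A B).lift_ι f hf x

section

variable {H K : Type u}
  [NormedAddCommGroup H] [InnerProductSpace ℂ H] [CompleteSpace H]
  [NormedAddCommGroup K] [InnerProductSpace ℂ K] [CompleteSpace K]

theorem norm_tensorRep_le (π : A →⋆ₐ[ℂ] BddOp H) (ρ : B →⋆ₐ[ℂ] BddOp K) (x : A ⊗[ℂ] B) :
    ‖tensorRep π ρ x‖ ≤ (spatialNorm A B).toSeminorm x :=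
  CStarSeminorm.le_ofFamily (fun i : HilbertRep A × HilbertRep B => tensorRep i.1.rep i.2.rep)
    (bddAbove_tensorRep A B) (⟨H, π⟩, ⟨K, ρ⟩) x

/-- The representation `π ⊗ ρ` of the spatial tensor product. -/
def SpatialTensor.rep (π : A →⋆ₐ[ℂ] BddOp H) (ρ : B →⋆ₐ[ℂ] BddOp K) :
    SpatialTensor A B →⋆ₐ[ℂ] BddOp (HilbertTensor H K) :=
  SpatialTensor.lift (tensorRep π ρ) (norm_tensorRep_le π ρ)

theorem SpatialTensor.rep_ofAlg (π : A →⋆ₐ[ℂ] BddOp H) (ρ : B →⋆ₐ[ℂ] BddOp K) (x : A ⊗[ℂ] B) :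
    SpatialTensor.rep π ρ (ofAlg A B x) = tensorRep π ρ x :=
  SpatialTensor.lift_ofAlg _ _ x

end

theorem SpatialTensor.norm_le {z : SpatialTensor A B} {c : ℝ} (hc : 0 ≤ c)
    (h : ∀ (π : HilbertRep A) (ρ : HilbertRep B), ‖SpatialTensor.rep π.rep ρ.rep z‖ ≤ c) :
    ‖z‖ ≤ c :=
  (spatialNorm A B).norm_le_of_family
    (fun i : HilbertRep A × HilbertRep B => tensorRep i.1.rep i.2.rep)
    (fun i => norm_tensorRep_le i.1.rep i.2.rep)
    (fun _ _ hC h => CStarSeminorm.ofFamily_le _ _ hC h) hc (fun i => h i.1 i.2)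

theorem SpatialTensor.hom_ext {D : Type*} [CStarAlgebra D] {f g : SpatialTensor A B →⋆ₐ[ℂ] D}
    (h : ∀ a b, f (stmul a b) = g (stmul a b)) : f = g := by
  have h' : f.comp (ofAlg A B) = g.comp (ofAlg A B) := tensor_starHom_ext h
  ext z
  refine (denseRange_ofAlg A B).induction_on (p := fun z => f z = g z) z
    (isClosed_eq (continuous_starAlgHom f) (continuous_starAlgHom g)) ?_
  intro x
  exact DFunLike.congr_fun h' x

/-- The embedding `a ↦ a ⊗ 1`. -/
def inclLeft (A B : Type u) [CStarAlgebra A] [CStarAlgebra B] : A →⋆ₐ[ℂ] SpatialTensor A B :=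
  (ofAlg A B).comp (algInclLeft A B)

/-- The embedding `b ↦ 1 ⊗ b`. -/
def inclRight (A B : Type u) [CStarAlgebra A] [CStarAlgebra B] : B →⋆ₐ[ℂ] SpatialTensor A B :=
  (ofAlg A B).comp (algInclRight A B)

theorem inclLeft_apply (a : A) : inclLeft A B a = stmul a 1 := rfl

theorem inclRight_apply (b : B) : inclRight A B b = stmul 1 b := rfl

theorem stmul_mul_stmul (a a' : A) (b b' : B) :
    stmul a b * stmul a' b' = stmul (a * a') (b * b') := by
  rw [stmul, stmul, stmul, ← map_mul, Algebra.TensorProduct.tmul_mul_tmul]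

theorem incl_commute (a : A) (b : B) : Commute (inclLeft A B a) (inclRight A B b) := by
  rw [commute_iff_eq, inclLeft_apply, inclRight_apply, stmul_mul_stmul, stmul_mul_stmul, one_mul,
    mul_one, one_mul, mul_one]

section Map

variable {A' B' : Type u} [CStarAlgebra A'] [CStarAlgebra B']

/-- The map `a ⊗ b ↦ f a ⊗ g b` on the algebraic tensor product. -/
def mapAlg (f : A →⋆ₐ[ℂ] A') (g : B →⋆ₐ[ℂ] B') : A ⊗[ℂ] B →⋆ₐ[ℂ] SpatialTensor A' B' :=
  commLift ((inclLeft A' B').comp f) ((inclRight A' B').comp g)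
    fun a b => incl_commute (f a) (g b)

theorem mapAlg_tmul (f : A →⋆ₐ[ℂ] A') (g : B →⋆ₐ[ℂ] B') (a : A) (b : B) :
    mapAlg f g (a ⊗ₜ[ℂ] b) = stmul (f a) (g b) := by
  refine (commLift_tmul _ _ _ a b).trans ?_
  change stmul (f a) 1 * stmul 1 (g b) = _
  rw [stmul_mul_stmul, mul_one, one_mul]

theorem norm_mapAlg_le (f : A →⋆ₐ[ℂ] A') (g : B →⋆ₐ[ℂ] B') (x : A ⊗[ℂ] B) :
    ‖mapAlg f g x‖ ≤ (spatialNorm A B).toSeminorm x := by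
  refine SpatialTensor.norm_le (apply_nonneg _ x) fun π ρ => ?_
  have h : (SpatialTensor.rep π.rep ρ.rep).comp (mapAlg f g) =
      tensorRep (π.rep.comp f) (ρ.rep.comp g) :=
    tensor_starHom_ext fun a b => by
      rw [StarAlgHom.comp_apply, mapAlg_tmul, stmul, SpatialTensor.rep_ofAlg, tensorRep_tmul,
        tensorRep_tmul, StarAlgHom.comp_apply, StarAlgHom.comp_apply]
  have h' := DFunLike.congr_fun h x
  rw [StarAlgHom.comp_apply] at h'
  rw [h']
  exact norm_tensorRep_le (π.rep.comp f) (ρ.rep.comp g) x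

/-- The `*`-homomorphism `f ⊗ g` between spatial tensor products. -/
def SpatialTensor.map (f : A →⋆ₐ[ℂ] A') (g : B →⋆ₐ[ℂ] B') :
    SpatialTensor A B →⋆ₐ[ℂ] SpatialTensor A' B' :=
  SpatialTensor.lift (mapAlg f g) (norm_mapAlg_le f g)

theorem SpatialTensor.map_stmul (f : A →⋆ₐ[ℂ] A') (g : B →⋆ₐ[ℂ] B') (a : A) (b : B) :
    SpatialTensor.map f g (stmul a b) = stmul (f a) (g b) :=
  (SpatialTensor.lift_ofAlg _ _ _).trans (mapAlg_tmul f g a b)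

end Map

/-! ### The spatial tensor product of three C*-algebras -/

section Triple

variable (A B C)

theorem bddAbove_tensorRep₃ (x : (A ⊗[ℂ] B) ⊗[ℂ] C) :
    BddAbove (Set.range fun i : (HilbertRep A × HilbertRep B) × HilbertRep C =>
      ‖tensorRep (tensorRep i.1.1.rep i.1.2.rep) i.2.rep x‖) := by
  induction x using TensorProduct.induction_on with
  | zero =>
    refine ⟨0, ?_⟩
    rintro _ ⟨i, rfl⟩
    change ‖tensorRep (tensorRep i.1.1.rep i.1.2.rep) i.2.rep 0‖ ≤ 0
    rw [map_zero, norm_zero]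
  | tmul y c =>
    refine ⟨(spatialNorm A B).toSeminorm y * ‖c‖, ?_⟩
    rintro _ ⟨i, rfl⟩
    exact (norm_tensorRep_tmul_le (tensorRep i.1.1.rep i.1.2.rep) i.2.rep y c).trans
      (mul_le_mul_of_nonneg_right (norm_tensorRep_le i.1.1.rep i.1.2.rep y) (norm_nonneg _))
  | add x y hx hy =>
    obtain ⟨c, hc⟩ := hx
    obtain ⟨d, hd⟩ := hy
    refine ⟨c + d, ?_⟩
    rintro _ ⟨i, rfl⟩
    change ‖tensorRep (tensorRep i.1.1.rep i.1.2.rep) i.2.rep (x + y)‖ ≤ c + d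
    rw [map_add]
    exact (norm_add_le _ _).trans (add_le_add (hc ⟨i, rfl⟩) (hd ⟨i, rfl⟩))

/-- The spatial C*-norm on the algebraic tensor product of three C*-algebras: the supremum of the
operator norms `‖(π ⊗ ρ ⊗ σ) x‖` over all Hilbert space representations. -/
def spatialNorm₃ : CStarSeminorm ((A ⊗[ℂ] B) ⊗[ℂ] C) :=
  CStarSeminorm.ofFamily (fun i : (HilbertRep A × HilbertRep B) × HilbertRep C =>
    tensorRep (tensorRep i.1.1.rep i.1.2.rep) i.2.rep) (bddAbove_tensorRep₃ A B C)

/-- The spatial tensor product of three unital C*-algebras. -/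
def SpatialTensor₃ : Type u := (spatialNorm₃ A B C).Compl

instance : CStarAlgebra (SpatialTensor₃ A B C) :=
  inferInstanceAs (CStarAlgebra (spatialNorm₃ A B C).Compl)

/-- The canonical map from the algebraic to the spatial threefold tensor product. -/
def ofAlg₃ : (A ⊗[ℂ] B) ⊗[ℂ] C →⋆ₐ[ℂ] SpatialTensor₃ A B C := (spatialNorm₃ A B C).ι

theorem denseRange_ofAlg₃ : DenseRange (ofAlg₃ A B C) := (spatialNorm₃ A B C).denseRange_ι

variable {A B C}

/-- Elementary tensors in the threefold spatial tensor product. -/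
def stmul₃ (a : A) (b : B) (c : C) : SpatialTensor₃ A B C :=
  ofAlg₃ A B C ((a ⊗ₜ[ℂ] b) ⊗ₜ[ℂ] c)

theorem stmul₃_mul_stmul₃ (a a' : A) (b b' : B) (c c' : C) :
    stmul₃ a b c * stmul₃ a' b' c' = stmul₃ (a * a') (b * b') (c * c') := by
  rw [stmul₃, stmul₃, stmul₃, ← map_mul, Algebra.TensorProduct.tmul_mul_tmul,
    Algebra.TensorProduct.tmul_mul_tmul]

section

variable {H K L : Type u}
  [NormedAddCommGroup H] [InnerProductSpace ℂ H] [CompleteSpace H]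
  [NormedAddCommGroup K] [InnerProductSpace ℂ K] [CompleteSpace K]
  [NormedAddCommGroup L] [InnerProductSpace ℂ L] [CompleteSpace L]

theorem norm_tensorRep₃_le (π : A →⋆ₐ[ℂ] BddOp H) (ρ : B →⋆ₐ[ℂ] BddOp K) (σ : C →⋆ₐ[ℂ] BddOp L)
    (x : (A ⊗[ℂ] B) ⊗[ℂ] C) :
    ‖tensorRep (tensorRep π ρ) σ x‖ ≤ (spatialNorm₃ A B C).toSeminorm x :=
  CStarSeminorm.le_ofFamily (fun i : (HilbertRep A × HilbertRep B) × HilbertRep C =>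
    tensorRep (tensorRep i.1.1.rep i.1.2.rep) i.2.rep) (bddAbove_tensorRep₃ A B C)
    ((⟨H, π⟩, ⟨K, ρ⟩), ⟨L, σ⟩) x

/-- The representation `π ⊗ ρ ⊗ σ` of the threefold spatial tensor product. -/
def SpatialTensor₃.rep (π : A →⋆ₐ[ℂ] BddOp H) (ρ : B →⋆ₐ[ℂ] BddOp K) (σ : C →⋆ₐ[ℂ] BddOp L) :
    SpatialTensor₃ A B C →⋆ₐ[ℂ] BddOp (HilbertTensor (HilbertTensor H K) L) :=
  (spatialNorm₃ A B C).lift (tensorRep (tensorRep π ρ) σ) (norm_tensorRep₃_le π ρ σ)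

theorem SpatialTensor₃.rep_ofAlg₃ (π : A →⋆ₐ[ℂ] BddOp H) (ρ : B →⋆ₐ[ℂ] BddOp K)
    (σ : C →⋆ₐ[ℂ] BddOp L) (x : (A ⊗[ℂ] B) ⊗[ℂ] C) :
    SpatialTensor₃.rep π ρ σ (ofAlg₃ A B C x) = tensorRep (tensorRep π ρ) σ x :=
  (spatialNorm₃ A B C).lift_ι _ _ x

end

theorem SpatialTensor₃.norm_le {z : SpatialTensor₃ A B C} {c : ℝ} (hc : 0 ≤ c)
    (h : ∀ (π : HilbertRep A) (ρ : HilbertRep B) (σ : HilbertRep C),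
      ‖SpatialTensor₃.rep π.rep ρ.rep σ.rep z‖ ≤ c) : ‖z‖ ≤ c :=
  (spatialNorm₃ A B C).norm_le_of_family
    (fun i : (HilbertRep A × HilbertRep B) × HilbertRep C =>
      tensorRep (tensorRep i.1.1.rep i.1.2.rep) i.2.rep)
    (fun i => norm_tensorRep₃_le i.1.1.rep i.1.2.rep i.2.rep)
    (fun _ _ hC h => CStarSeminorm.ofFamily_le _ _ hC h) hc (fun i => h i.1.1 i.1.2 i.2)

/-- The embedding `a ↦ a ⊗ 1 ⊗ 1`. -/
def incl₁ : A →⋆ₐ[ℂ] SpatialTensor₃ A B C :=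
  (ofAlg₃ A B C).comp ((algInclLeft (A ⊗[ℂ] B) C).comp (algInclLeft A B))

/-- The embedding `c ↦ 1 ⊗ 1 ⊗ c`. -/
def incl₃ : C →⋆ₐ[ℂ] SpatialTensor₃ A B C :=
  (ofAlg₃ A B C).comp (algInclRight (A ⊗[ℂ] B) C)

/-- The map `a ⊗ b ↦ a ⊗ b ⊗ 1` on the algebraic tensor product. -/
def incl₁₂Alg : A ⊗[ℂ] B →⋆ₐ[ℂ] SpatialTensor₃ A B C :=
  (ofAlg₃ A B C).comp (algInclLeft (A ⊗[ℂ] B) C)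

theorem incl₁₂Alg_tmul (a : A) (b : B) :
    incl₁₂Alg (C := C) (a ⊗ₜ[ℂ] b) = stmul₃ a b 1 := rfl

theorem norm_incl₁₂Alg_le (x : A ⊗[ℂ] B) :
    ‖incl₁₂Alg (C := C) x‖ ≤ (spatialNorm A B).toSeminorm x := by
  refine SpatialTensor₃.norm_le (apply_nonneg _ x) fun π ρ σ => ?_
  have h : SpatialTensor₃.rep π.rep ρ.rep σ.rep (incl₁₂Alg x) =
      tensorRep (tensorRep π.rep ρ.rep) σ.rep (x ⊗ₜ[ℂ] (1 : C)) :=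
    SpatialTensor₃.rep_ofAlg₃ π.rep ρ.rep σ.rep (x ⊗ₜ[ℂ] (1 : C))
  rw [tensorRep_tmul, map_one, map_one, mul_one] at h
  rw [h]
  exact (NonUnitalStarAlgHom.norm_apply_le (ampLeft σ.space) _).trans
    (norm_tensorRep_le π.rep ρ.rep x)

/-- The embedding `a ⊗ b ↦ a ⊗ b ⊗ 1` of spatial tensor products. -/
def incl₁₂ : SpatialTensor A B →⋆ₐ[ℂ] SpatialTensor₃ A B C :=
  SpatialTensor.lift incl₁₂Alg norm_incl₁₂Alg_le

theorem incl₁₂_stmul (a : A) (b : B) : incl₁₂ (C := C) (stmul a b) = stmul₃ a b 1 :=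
  SpatialTensor.lift_ofAlg _ _ _

end Triple

end Spatial

section HilbertAssoc

variable {H K L : Type u}
  [NormedAddCommGroup H] [InnerProductSpace ℂ H]
  [NormedAddCommGroup K] [InnerProductSpace ℂ K]
  [NormedAddCommGroup L] [InnerProductSpace ℂ L]

/-- The continuous linear map `x ↦ x ⊗ y`. -/
def htmulLeft (y : K) : H →L[ℂ] HilbertTensor H K :=
  (hemb H K).toContinuousLinearMap.comp ((TensorProduct.mkL ℂ H K).flip y)

/-- The continuous linear map `y ↦ x ⊗ y`. -/
def htmulRight (x : H) : K →L[ℂ] HilbertTensor H K :=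
  (hemb H K).toContinuousLinearMap.comp (TensorProduct.mkL ℂ H K x)

theorem htmulLeft_apply (x : H) (y : K) : htmulLeft y x = htmul x y := rfl

theorem htmulRight_apply (x : H) (y : K) : htmulRight x y = htmul x y := rfl

theorem hilbert_ext₃ {E : Type*} [NormedAddCommGroup E] [NormedSpace ℂ E]
    {S T : HilbertTensor (HilbertTensor H K) L →L[ℂ] E}
    (h : ∀ (x : H) (y : K) (z : L), S (htmul (htmul x y) z) = T (htmul (htmul x y) z)) :
    S = T := by
  refine hilbert_ext fun ζ z => ?_
  have h1 : S.comp (htmulLeft z) = T.comp (htmulLeft z) := hilbert_ext fun x y => h x y z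
  exact DFunLike.congr_fun h1 ζ

/-- The isometric embedding of the algebraic threefold tensor product. -/
def hemb₃ : (H ⊗[ℂ] K) ⊗[ℂ] L →ₗᵢ[ℂ] HilbertTensor (HilbertTensor H K) L :=
  (hemb (HilbertTensor H K) L).comp (TensorProduct.mapIsometry (hemb H K) LinearIsometry.id)

theorem hemb₃_tmul (x : H) (y : K) (z : L) :
    hemb₃ ((x ⊗ₜ[ℂ] y) ⊗ₜ[ℂ] z) = htmul (htmul x y) z := rfl

theorem denseRange_hemb₃ :
    DenseRange (hemb₃ : (H ⊗[ℂ] K) ⊗[ℂ] L →ₗᵢ[ℂ] HilbertTensor (HilbertTensor H K) L) := by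
  set R : Submodule ℂ (HilbertTensor (HilbertTensor H K) L) :=
    (LinearMap.range (hemb₃ : (H ⊗[ℂ] K) ⊗[ℂ] L →ₗᵢ[ℂ] _).toLinearMap).topologicalClosure with hR
  have h1 : ∀ (ζ : HilbertTensor H K) (z : L), htmul ζ z ∈ R := by
    intro ζ z
    refine (denseRange_hemb H K).induction_on (p := fun ζ => htmul ζ z ∈ R) ζ
      ((Submodule.isClosed_topologicalClosure _).preimage (htmulLeft z).continuous) ?_
    intro w
    exact Submodule.le_topologicalClosure _ ⟨w ⊗ₜ[ℂ] z, rfl⟩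
  have h2 : ∀ ζ, ζ ∈ R := by
    intro ζ
    refine (denseRange_hemb (HilbertTensor H K) L).induction_on (p := fun ζ => ζ ∈ R) ζ
      (Submodule.isClosed_topologicalClosure _) ?_
    intro w
    induction w using TensorProduct.induction_on with
    | zero => rw [map_zero]; exact R.zero_mem
    | tmul a z => exact h1 a z
    | add a b ha hb => rw [map_add]; exact R.add_mem ha hb
  intro ζ
  exact h2 ζ

/-- The associativity isometry of Hilbert space tensor products. -/
theorem exists_hilbert_assoc :
    ∃ U : HilbertTensor (HilbertTensor H K) L →L[ℂ] HilbertTensor H (HilbertTensor K L),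
      (∀ ξ, ‖U ξ‖ = ‖ξ‖) ∧ ∀ x y z, U (htmul (htmul x y) z) = htmul x (htmul y z) := by
  let e : (H ⊗[ℂ] K) ⊗[ℂ] L →L[ℂ] HilbertTensor (HilbertTensor H K) L :=
    hemb₃.toContinuousLinearMap
  let f : (H ⊗[ℂ] K) ⊗[ℂ] L →ₗᵢ[ℂ] HilbertTensor H (HilbertTensor K L) :=
    ((hemb H (HilbertTensor K L)).comp
      (TensorProduct.mapIsometry LinearIsometry.id (hemb K L))).comp
      (TensorProduct.assocIsometry ℂ H K L).toLinearIsometry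
  have he : IsUniformInducing e := (hemb₃ (H := H) (K := K) (L := L)).isometry.isUniformInducing
  have hd : DenseRange e := denseRange_hemb₃
  let U := f.toContinuousLinearMap.extend e
  have hU : ∀ w, U (e w) = f w := fun w =>
    ContinuousLinearMap.extend_eq f.toContinuousLinearMap hd he w
  refine ⟨U, fun ξ => ?_, fun x y z => ?_⟩
  · refine hd.induction_on (p := fun ξ => ‖U ξ‖ = ‖ξ‖) ξ
      (isClosed_eq U.continuous.norm continuous_norm) ?_
    intro w
    rw [hU, f.norm_map]
    exact (hemb₃.norm_map w).symm
  · exact hU ((x ⊗ₜ[ℂ] y) ⊗ₜ[ℂ] z)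

end HilbertAssoc

section Triple

variable {A B C : Type u} [CStarAlgebra A] [CStarAlgebra B] [CStarAlgebra C]
  {H K L : Type u}
  [NormedAddCommGroup H] [InnerProductSpace ℂ H] [CompleteSpace H]
  [NormedAddCommGroup K] [InnerProductSpace ℂ K] [CompleteSpace K]
  [NormedAddCommGroup L] [InnerProductSpace ℂ L] [CompleteSpace L]

theorem rep₃_stmul₃_apply (π : A →⋆ₐ[ℂ] BddOp H) (ρ : B →⋆ₐ[ℂ] BddOp K) (σ : C →⋆ₐ[ℂ] BddOp L)
    (a : A) (b : B) (c : C) (x : H) (y : K) (z : L) :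
    (SpatialTensor₃.rep π ρ σ (stmul₃ a b c)).toCLM (htmul (htmul x y) z) =
      htmul (htmul ((π a).toCLM x) ((ρ b).toCLM y)) ((σ c).toCLM z) := by
  rw [stmul₃, SpatialTensor₃.rep_ofAlg₃, tensorRep_tmul_apply, tensorRep_tmul_apply]

theorem rep_stmul_apply (π : A →⋆ₐ[ℂ] BddOp H) (ρ : B →⋆ₐ[ℂ] BddOp K)
    (a : A) (b : B) (x : H) (y : K) :
    (SpatialTensor.rep π ρ (stmul a b)).toCLM (htmul x y) =
      htmul ((π a).toCLM x) ((ρ b).toCLM y) := by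
  rw [stmul, SpatialTensor.rep_ofAlg, tensorRep_tmul_apply]

/-- An operator on a threefold Hilbert space tensor product corresponds under re-bracketing to an
operator on the other one. -/
def Rebracket (S : BddOp (HilbertTensor (HilbertTensor H K) L))
    (T : BddOp (HilbertTensor H (HilbertTensor K L))) : Prop :=
  ∀ U : HilbertTensor (HilbertTensor H K) L →L[ℂ] HilbertTensor H (HilbertTensor K L),
    (∀ x y z, U (htmul (htmul x y) z) = htmul x (htmul y z)) →
      ∀ ξ, U (S.toCLM ξ) = T.toCLM (U ξ)

theorem Rebracket.norm_le {S : BddOp (HilbertTensor (HilbertTensor H K) L)}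
    {T : BddOp (HilbertTensor H (HilbertTensor K L))} (h : Rebracket S T) : ‖S‖ ≤ ‖T‖ := by
  obtain ⟨U, hU, hU'⟩ := exists_hilbert_assoc (H := H) (K := K) (L := L)
  rw [← BddOp.norm_toCLM S]
  refine ContinuousLinearMap.opNorm_le_bound _ (norm_nonneg _) fun ξ => ?_
  rw [← hU, h U hU' ξ, ← hU ξ, ← BddOp.norm_toCLM T]
  exact ContinuousLinearMap.le_opNorm _ _

theorem Rebracket.of_htmul {S : BddOp (HilbertTensor (HilbertTensor H K) L)}
    {T : BddOp (HilbertTensor H (HilbertTensor K L))}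
    (h : ∀ U : HilbertTensor (HilbertTensor H K) L →L[ℂ] HilbertTensor H (HilbertTensor K L),
      (∀ x y z, U (htmul (htmul x y) z) = htmul x (htmul y z)) →
      ∀ x y z, U (S.toCLM (htmul (htmul x y) z)) = T.toCLM (htmul x (htmul y z))) :
    Rebracket S T := by
  intro U hU ξ
  have h1 : U.comp S.toCLM = T.toCLM.comp U := hilbert_ext₃ fun x y z => by
    rw [ContinuousLinearMap.comp_apply, ContinuousLinearMap.comp_apply, hU]
    exact h U hU x y z
  exact DFunLike.congr_fun h1 ξ

theorem Rebracket.mul {S S' : BddOp (HilbertTensor (HilbertTensor H K) L)}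
    {T T' : BddOp (HilbertTensor H (HilbertTensor K L))} (h : Rebracket S T)
    (h' : Rebracket S' T') : Rebracket (S * S') (T * T') := by
  intro U hU ξ
  rw [BddOp.mul_toCLM, BddOp.mul_toCLM, h U hU, h' U hU]

theorem BddOp.add_toCLM {E : Type u} [NormedAddCommGroup E] [InnerProductSpace ℂ E]
    [CompleteSpace E] (S T : BddOp E) (x : E) : (S + T).toCLM x = S.toCLM x + T.toCLM x := rfl

theorem BddOp.zero_toCLM {E : Type u} [NormedAddCommGroup E] [InnerProductSpace ℂ E]
    [CompleteSpace E] (x : E) : (0 : BddOp E).toCLM x = 0 := rfl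

theorem BddOp.continuous_apply {E : Type u} [NormedAddCommGroup E] [InnerProductSpace ℂ E]
    [CompleteSpace E] (x : E) : Continuous fun T : BddOp E => T.toCLM x :=
  (ContinuousLinearMap.apply ℂ E x).continuous

theorem Rebracket.add {S S' : BddOp (HilbertTensor (HilbertTensor H K) L)}
    {T T' : BddOp (HilbertTensor H (HilbertTensor K L))} (h : Rebracket S T)
    (h' : Rebracket S' T') : Rebracket (S + S') (T + T') := by
  intro U hU ξ
  rw [BddOp.add_toCLM, BddOp.add_toCLM, map_add, h U hU, h' U hU]

theorem Rebracket.zero : Rebracket (0 : BddOp (HilbertTensor (HilbertTensor H K) L))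
    (0 : BddOp (HilbertTensor H (HilbertTensor K L))) := by
  intro U hU ξ
  rw [BddOp.zero_toCLM, BddOp.zero_toCLM, map_zero]

/-- The embedding `b ↦ 1 ⊗ b ⊗ 1`. -/
def incl₂ : B →⋆ₐ[ℂ] SpatialTensor₃ A B C :=
  (ofAlg₃ A B C).comp ((algInclLeft (A ⊗[ℂ] B) C).comp (algInclRight A B))

theorem incl₁_apply (a : A) : incl₁ (B := B) (C := C) a = stmul₃ a 1 1 := rfl

theorem incl₂_apply (b : B) : incl₂ (A := A) (C := C) b = stmul₃ 1 b 1 := rfl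

theorem incl₃_apply (c : C) : incl₃ (A := A) (B := B) c = stmul₃ 1 1 c := rfl

/-- The map `b ⊗ c ↦ 1 ⊗ b ⊗ c` on the algebraic tensor product. -/
def incl₂₃Alg : B ⊗[ℂ] C →⋆ₐ[ℂ] SpatialTensor₃ A B C :=
  commLift incl₂ incl₃ fun b c => by
    rw [commute_iff_eq, incl₂_apply, incl₃_apply, stmul₃_mul_stmul₃, stmul₃_mul_stmul₃]
    simp only [one_mul, mul_one]

theorem incl₂₃Alg_tmul (b : B) (c : C) : incl₂₃Alg (A := A) (b ⊗ₜ[ℂ] c) = stmul₃ 1 b c := by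
  refine (commLift_tmul _ _ _ b c).trans ?_
  rw [incl₂_apply, incl₃_apply, stmul₃_mul_stmul₃]
  simp only [one_mul, mul_one]

theorem rebracket_incl₂₃Alg (π : A →⋆ₐ[ℂ] BddOp H) (ρ : B →⋆ₐ[ℂ] BddOp K) (σ : C →⋆ₐ[ℂ] BddOp L)
    (w : B ⊗[ℂ] C) :
    Rebracket (SpatialTensor₃.rep π ρ σ (incl₂₃Alg w)) (ampRight H (tensorRep ρ σ w)) := by
  induction w using TensorProduct.induction_on with
  | zero => rw [map_zero, map_zero, map_zero, map_zero]; exact Rebracket.zero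
  | tmul b c =>
    refine Rebracket.of_htmul fun U hU x y z => ?_
    rw [incl₂₃Alg_tmul, rep₃_stmul₃_apply, ampRight_htmul, tensorRep_tmul_apply, hU, map_one]
    rfl
  | add v w hv hw =>
    rw [map_add, map_add, map_add, map_add]
    exact hv.add hw

theorem norm_incl₂₃Alg_le (w : B ⊗[ℂ] C) :
    ‖incl₂₃Alg (A := A) w‖ ≤ (spatialNorm B C).toSeminorm w := by
  refine SpatialTensor₃.norm_le (apply_nonneg _ w) fun π ρ σ => ?_
  refine (rebracket_incl₂₃Alg π.rep ρ.rep σ.rep w).norm_le.trans ?_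
  exact (NonUnitalStarAlgHom.norm_apply_le (ampRight π.space) _).trans
    (norm_tensorRep_le ρ.rep σ.rep w)

/-- The embedding `b ⊗ c ↦ 1 ⊗ b ⊗ c` of spatial tensor products. -/
def incl₂₃ : SpatialTensor B C →⋆ₐ[ℂ] SpatialTensor₃ A B C :=
  SpatialTensor.lift incl₂₃Alg norm_incl₂₃Alg_le

theorem incl₂₃_stmul (b : B) (c : C) : incl₂₃ (A := A) (stmul b c) = stmul₃ 1 b c :=
  (SpatialTensor.lift_ofAlg _ _ _).trans (incl₂₃Alg_tmul b c)

theorem rebracket_incl₂₃ (π : A →⋆ₐ[ℂ] BddOp H) (ρ : B →⋆ₐ[ℂ] BddOp K) (σ : C →⋆ₐ[ℂ] BddOp L)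
    (w : SpatialTensor B C) :
    Rebracket (SpatialTensor₃.rep π ρ σ (incl₂₃ w)) (ampRight H (SpatialTensor.rep ρ σ w)) := by
  intro U hU ξ
  refine (denseRange_ofAlg B C).induction_on
    (p := fun w => U ((SpatialTensor₃.rep π ρ σ (incl₂₃ w)).toCLM ξ) =
      (ampRight H (SpatialTensor.rep ρ σ w)).toCLM (U ξ)) w (isClosed_eq ?_ ?_) ?_
  · exact U.continuous.comp ((BddOp.continuous_apply ξ).comp
      (continuous_starAlgHom ((SpatialTensor₃.rep π ρ σ).comp incl₂₃)))
  · exact (BddOp.continuous_apply (U ξ)).comp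
      (continuous_starAlgHom ((ampRight H).comp (SpatialTensor.rep ρ σ)))
  · intro v
    have h1 : incl₂₃ (A := A) (ofAlg B C v) = incl₂₃Alg v := SpatialTensor.lift_ofAlg _ _ v
    rw [h1, SpatialTensor.rep_ofAlg]
    exact rebracket_incl₂₃Alg π ρ σ v U hU ξ

theorem rebracket_incl₁ (π : A →⋆ₐ[ℂ] BddOp H) (ρ : B →⋆ₐ[ℂ] BddOp K) (σ : C →⋆ₐ[ℂ] BddOp L)
    (a : A) :
    Rebracket (SpatialTensor₃.rep π ρ σ (incl₁ a)) (ampLeft (HilbertTensor K L) (π a)) := by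
  refine Rebracket.of_htmul fun U hU x y z => ?_
  rw [incl₁_apply, rep₃_stmul₃_apply, ampLeft_htmul, hU, map_one, map_one]
  rfl

theorem rep₃_incl₃ (π : A →⋆ₐ[ℂ] BddOp H) (ρ : B →⋆ₐ[ℂ] BddOp K) (σ : C →⋆ₐ[ℂ] BddOp L)
    (c : C) :
    SpatialTensor₃.rep π ρ σ (incl₃ c) = ampRight (HilbertTensor H K) (σ c) := by
  refine (SpatialTensor₃.rep_ofAlg₃ π ρ σ ((1 : A ⊗[ℂ] B) ⊗ₜ[ℂ] c)).trans ?_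
  rw [tensorRep_tmul, map_one, map_one, one_mul]

theorem rep₃_incl₁₂ (π : A →⋆ₐ[ℂ] BddOp H) (ρ : B →⋆ₐ[ℂ] BddOp K) (σ : C →⋆ₐ[ℂ] BddOp L)
    (w : SpatialTensor A B) :
    SpatialTensor₃.rep π ρ σ (incl₁₂ w) = ampLeft L (SpatialTensor.rep π ρ w) := by
  have h : (SpatialTensor₃.rep π ρ σ).comp incl₁₂ = (ampLeft L).comp (SpatialTensor.rep π ρ) :=
    SpatialTensor.hom_ext fun a b => by
      rw [StarAlgHom.comp_apply, StarAlgHom.comp_apply, incl₁₂_stmul, stmul, stmul₃,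
        SpatialTensor₃.rep_ofAlg₃, SpatialTensor.rep_ofAlg, tensorRep_tmul, map_one, map_one,
        mul_one]
  exact DFunLike.congr_fun h w

theorem incl₁₂_commute (w : SpatialTensor A B) (c : C) : Commute (incl₁₂ w) (incl₃ c) := by
  refine (denseRange_ofAlg A B).induction_on
    (p := fun w => incl₁₂ (C := C) w * incl₃ c = incl₃ c * incl₁₂ w) w
    (isClosed_eq ((continuous_starAlgHom incl₁₂).mul continuous_const)
      (continuous_const.mul (continuous_starAlgHom incl₁₂))) ?_
  intro v
  have h1 : incl₁₂ (C := C) (ofAlg A B v) = ofAlg₃ A B C (v ⊗ₜ[ℂ] 1) :=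
    SpatialTensor.lift_ofAlg _ _ v
  have h2 : incl₃ (A := A) (B := B) c = ofAlg₃ A B C (1 ⊗ₜ[ℂ] c) := rfl
  rw [h1, h2, ← map_mul, ← map_mul, Algebra.TensorProduct.tmul_mul_tmul,
    Algebra.TensorProduct.tmul_mul_tmul, one_mul, one_mul, mul_one, mul_one]

theorem incl₂₃_commute (a : A) (w : SpatialTensor B C) : Commute (incl₁ a) (incl₂₃ w) := by
  refine (denseRange_ofAlg B C).induction_on
    (p := fun w => incl₁ a * incl₂₃ w = incl₂₃ w * incl₁ a) w
    (isClosed_eq (continuous_const.mul (continuous_starAlgHom incl₂₃))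
      ((continuous_starAlgHom incl₂₃).mul continuous_const)) ?_
  intro v
  have h1 : incl₂₃ (A := A) (ofAlg B C v) = incl₂₃Alg v := SpatialTensor.lift_ofAlg _ _ v
  rw [h1]
  induction v using TensorProduct.induction_on with
  | zero => rw [map_zero, mul_zero, zero_mul]
  | tmul b c =>
    rw [incl₂₃Alg_tmul, incl₁_apply, stmul₃_mul_stmul₃, stmul₃_mul_stmul₃, one_mul, one_mul,
      one_mul, mul_one, mul_one, mul_one]
  | add v w hv hw =>
    rw [map_add, mul_add, add_mul, hv (SpatialTensor.lift_ofAlg _ _ v),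
      hw (SpatialTensor.lift_ofAlg _ _ w)]

variable {X : Type u} [CStarAlgebra X]

/-- The map `x ⊗ c ↦ f x ⊗ c` on the algebraic tensor product. -/
def mapLeft₃Alg (f : X →⋆ₐ[ℂ] SpatialTensor A B) : X ⊗[ℂ] C →⋆ₐ[ℂ] SpatialTensor₃ A B C :=
  commLift (incl₁₂.comp f) incl₃ fun x c => incl₁₂_commute (f x) c

theorem mapLeft₃Alg_tmul (f : X →⋆ₐ[ℂ] SpatialTensor A B) (x : X) (c : C) :
    mapLeft₃Alg f (x ⊗ₜ[ℂ] c) = incl₁₂ (f x) * incl₃ c :=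
  commLift_tmul _ _ _ x c

theorem norm_mapLeft₃Alg_le (f : X →⋆ₐ[ℂ] SpatialTensor A B) (w : X ⊗[ℂ] C) :
    ‖mapLeft₃Alg f w‖ ≤ (spatialNorm X C).toSeminorm w := by
  refine SpatialTensor₃.norm_le (apply_nonneg _ w) fun π ρ σ => ?_
  have h : (SpatialTensor₃.rep π.rep ρ.rep σ.rep).comp (mapLeft₃Alg f) =
      tensorRep ((SpatialTensor.rep π.rep ρ.rep).comp f) σ.rep :=
    tensor_starHom_ext fun x c => by
      rw [StarAlgHom.comp_apply, mapLeft₃Alg_tmul, map_mul, rep₃_incl₁₂, rep₃_incl₃,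
        tensorRep_tmul, StarAlgHom.comp_apply]
  have h' := DFunLike.congr_fun h w
  rw [StarAlgHom.comp_apply] at h'
  rw [h']
  exact norm_tensorRep_le ((SpatialTensor.rep π.rep ρ.rep).comp f) σ.rep w

/-- The `*`-homomorphism `f ⊗ ι : X ⊗ C → A ⊗ B ⊗ C`, where `f : X → A ⊗ B`. -/
def mapLeft₃ (f : X →⋆ₐ[ℂ] SpatialTensor A B) : SpatialTensor X C →⋆ₐ[ℂ] SpatialTensor₃ A B C :=
  SpatialTensor.lift (mapLeft₃Alg f) (norm_mapLeft₃Alg_le f)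

theorem mapLeft₃_stmul (f : X →⋆ₐ[ℂ] SpatialTensor A B) (x : X) (c : C) :
    mapLeft₃ f (stmul x c) = incl₁₂ (f x) * incl₃ c :=
  (SpatialTensor.lift_ofAlg _ _ _).trans (mapLeft₃Alg_tmul f x c)

/-- The map `a ⊗ x ↦ a ⊗ f x` on the algebraic tensor product. -/
def mapRight₃Alg (f : X →⋆ₐ[ℂ] SpatialTensor B C) : A ⊗[ℂ] X →⋆ₐ[ℂ] SpatialTensor₃ A B C :=
  commLift incl₁ (incl₂₃.comp f) fun a x => incl₂₃_commute a (f x)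

theorem mapRight₃Alg_tmul (f : X →⋆ₐ[ℂ] SpatialTensor B C) (a : A) (x : X) :
    mapRight₃Alg f (a ⊗ₜ[ℂ] x) = incl₁ a * incl₂₃ (f x) :=
  commLift_tmul _ _ _ a x

theorem norm_mapRight₃Alg_le (f : X →⋆ₐ[ℂ] SpatialTensor B C) (w : A ⊗[ℂ] X) :
    ‖mapRight₃Alg f w‖ ≤ (spatialNorm A X).toSeminorm w := by
  refine SpatialTensor₃.norm_le (apply_nonneg _ w) fun π ρ σ => ?_
  have h : ∀ v : A ⊗[ℂ] X,
      Rebracket (SpatialTensor₃.rep π.rep ρ.rep σ.rep (mapRight₃Alg f v))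
        (tensorRep π.rep ((SpatialTensor.rep ρ.rep σ.rep).comp f) v) := by
    intro v
    induction v using TensorProduct.induction_on with
    | zero => rw [map_zero, map_zero, map_zero]; exact Rebracket.zero
    | tmul a x =>
      rw [mapRight₃Alg_tmul, map_mul, tensorRep_tmul, StarAlgHom.comp_apply]
      exact (rebracket_incl₁ π.rep ρ.rep σ.rep a).mul
        (rebracket_incl₂₃ π.rep ρ.rep σ.rep (f x))
    | add v w hv hw =>
      rw [map_add, map_add, map_add]
      exact hv.add hw
  exact (h w).norm_le.trans (norm_tensorRep_le π.rep ((SpatialTensor.rep ρ.rep σ.rep).comp f) w)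

/-- The `*`-homomorphism `ι ⊗ f : A ⊗ X → A ⊗ B ⊗ C`, where `f : X → B ⊗ C`. -/
def mapRight₃ (f : X →⋆ₐ[ℂ] SpatialTensor B C) : SpatialTensor A X →⋆ₐ[ℂ] SpatialTensor₃ A B C :=
  SpatialTensor.lift (mapRight₃Alg f) (norm_mapRight₃Alg_le f)

theorem mapRight₃_stmul (f : X →⋆ₐ[ℂ] SpatialTensor B C) (a : A) (x : X) :
    mapRight₃ f (stmul a x) = incl₁ a * incl₂₃ (f x) :=
  (SpatialTensor.lift_ofAlg _ _ _).trans (mapRight₃Alg_tmul f a x)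

end Triple

section Quotient

variable {A : Type u} [CStarAlgebra A]

theorem exists_approx_unit (I : Ideal A) [I.IsTwoSided] {i : A} (hi : i ∈ I) {ε : ℝ} (hε : 0 < ε) :
    ∃ v : A, 1 - v ∈ I ∧ IsSelfAdjoint v ∧ ‖v‖ ≤ 1 ∧ ‖i * v‖ ≤ ε := by
  set h : A := star i * i with hh
  have hsa : IsSelfAdjoint h := IsSelfAdjoint.star_mul_self i
  set δ : ℝ := ε ^ 2 with hδ
  have hδ0 : 0 < δ := by positivity
  have hpos : ∀ t : ℝ, 0 < |t| + δ := fun t => by positivity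
  let f : ℝ → ℝ := fun t => δ / (|t| + δ)
  let g : ℝ → ℝ := fun t => 1 / (|t| + δ)
  have hf : Continuous f := by
    refine Continuous.div continuous_const (by fun_prop) fun t => (hpos t).ne'
  have hg : Continuous g := by
    refine Continuous.div continuous_const (by fun_prop) fun t => (hpos t).ne'
  have hspec : ∀ t ∈ spectrum ℝ h, 0 ≤ t := spectrum_star_mul_self_nonneg
  have hvsa : IsSelfAdjoint (cfc f h) := cfc_predicate f h
  refine ⟨cfc f h, ?_, hvsa, ?_, ?_⟩
  · have h1 : 1 - cfc f h = h * cfc g h := by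
      rw [← cfc_one ℝ h, ← cfc_sub _ f h (by fun_prop) hf.continuousOn]
      nth_rewrite 2 [← cfc_id ℝ h]
      rw [← cfc_mul _ g h (by fun_prop) hg.continuousOn]
      refine cfc_congr fun t ht => ?_
      have := hpos t
      have h2 := abs_of_nonneg (hspec t ht)
      simp only [Pi.one_apply, f, g, id]
      rw [h2] at this ⊢
      field_simp
      ring
    rw [h1]
    exact I.mul_mem_right _ (I.mul_mem_left _ hi)
  · refine norm_cfc_le zero_le_one fun t _ => ?_
    have := hpos t
    rw [Real.norm_of_nonneg (by positivity), div_le_one this]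
    linarith [abs_nonneg t]
  · have h3 : ‖i * cfc f h‖ ^ 2 = ‖cfc f h * h * cfc f h‖ := by
      rw [sq, ← CStarRing.norm_star_mul_self, star_mul, hvsa.star_eq, hh]
      simp only [mul_assoc]
    have h4 : cfc f h * h * cfc f h = cfc (fun t => f t * t * f t) h := by
      nth_rewrite 2 [← cfc_id ℝ h]
      rw [← cfc_mul f _ h hf.continuousOn (by fun_prop),
        ← cfc_mul (fun x => f x * id x) f h (hf.mul continuous_id).continuousOn hf.continuousOn]
      rfl
    have h5 : ‖cfc (fun t => f t * t * f t) h‖ ≤ δ := by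
      refine norm_cfc_le hδ0.le fun t ht => ?_
      have hp := hpos t
      have ht0 := hspec t ht
      have h2 := abs_of_nonneg ht0
      simp only [f]
      rw [h2] at hp ⊢
      rw [Real.norm_of_nonneg (by positivity)]
      have e1 : δ / (t + δ) * t * (δ / (t + δ)) = δ * (δ * t / (t + δ) ^ 2) := by
        field_simp
      rw [e1]
      have e2 : δ * t / (t + δ) ^ 2 ≤ 1 := by
        rw [div_le_one (by positivity)]
        nlinarith [mul_nonneg hδ0.le ht0, sq_nonneg t, sq_nonneg δ]
      nlinarith
    rw [h4] at h3
    rw [← h3, hδ] at h5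
    exact (sq_le_sq₀ (norm_nonneg _) hε.le).mp h5

/-- A closed two-sided ideal of a C*-algebra is self-adjoint. -/
theorem star_mem_of_mem (I : Ideal A) [I.IsTwoSided] [hI : IsClosed (I : Set A)] {i : A}
    (hi : i ∈ I) : star i ∈ I := by
  have : star i ∈ closure (I : Set A) := by
    rw [Metric.mem_closure_iff]
    intro ε hε
    obtain ⟨v, hv, hsa, -, hv2⟩ := exists_approx_unit I hi (half_pos hε)
    refine ⟨(1 - v) * star i, I.mul_mem_right _ hv, ?_⟩
    rw [dist_eq_norm]
    have h1 : star i - (1 - v) * star i = star (i * v) := by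
      rw [star_mul, hsa.star_eq]; noncomm_ring
    rw [h1, norm_star]
    linarith
  rwa [hI.closure_eq] at this

variable (I : Ideal A) [I.IsTwoSided] [hI : IsClosed (I : Set A)]

theorem quot_norm_mk_le (a : A) : ‖Ideal.Quotient.mk I a‖ ≤ ‖a‖ :=
  Submodule.Quotient.norm_mk_le I a

theorem quot_exists_lt (x : A ⧸ I) {ε : ℝ} (hε : 0 < ε) :
    ∃ a, Ideal.Quotient.mk I a = x ∧ ‖a‖ < ‖x‖ + ε :=
  Submodule.Quotient.norm_mk_lt x hε

instance quotientNormedRing : NormedRing (A ⧸ I) :=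
  { Submodule.Quotient.normedAddCommGroup I, Ideal.Quotient.ring I with
    norm_mul_le := fun x y => by
      refine le_of_forall_pos_lt_add fun ε hε => ?_
      have hc : Filter.Tendsto (fun δ : ℝ => (‖x‖ + δ) * (‖y‖ + δ)) (nhdsWithin 0 (Set.Ioi 0))
          (nhds ((‖x‖ + 0) * (‖y‖ + 0))) :=
        Filter.Tendsto.mono_left (Continuous.tendsto (by fun_prop) 0) nhdsWithin_le_nhds
      rw [add_zero, add_zero] at hc
      have h1 := hc.eventually (gt_mem_nhds (lt_add_of_pos_right _ hε))
      obtain ⟨δ, hδ, hδ0⟩ := (h1.and self_mem_nhdsWithin).exists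
      obtain ⟨a, rfl, ha⟩ := quot_exists_lt I x hδ0
      obtain ⟨b, rfl, hb⟩ := quot_exists_lt I y hδ0
      refine lt_of_le_of_lt ?_ hδ
      change ‖Ideal.Quotient.mk I a * Ideal.Quotient.mk I b‖ ≤ _
      rw [← map_mul]
      refine (quot_norm_mk_le I (a * b)).trans ((norm_mul_le a b).trans ?_)
      exact mul_le_mul ha.le hb.le (norm_nonneg _) (le_trans (norm_nonneg _) ha.le) }

instance quotientNormedAlgebra : NormedAlgebra ℂ (A ⧸ I) :=
  { Ideal.Quotient.algebra ℂ with
    norm_smul_le := fun c x => (Submodule.Quotient.normedSpace I ℂ).norm_smul_le c x }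

/-- The involution of the quotient. -/
instance quotientStar : Star (A ⧸ I) where
  star := Quotient.map' star fun a b hab => by
    have h1 : a - b ∈ I := (Submodule.quotientRel_def I).mp hab
    rw [Submodule.quotientRel_def, ← star_sub]
    exact star_mem_of_mem I h1

theorem quot_star_mk (a : A) :
    star (Ideal.Quotient.mk I a) = Ideal.Quotient.mk I (star a) := rfl

instance quotientStarRing : StarRing (A ⧸ I) where
  star_involutive x := by
    obtain ⟨a, rfl⟩ := Ideal.Quotient.mk_surjective x
    rw [quot_star_mk, quot_star_mk, star_star]
  star_mul x y := by
    obtain ⟨a, rfl⟩ := Ideal.Quotient.mk_surjective x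
    obtain ⟨b, rfl⟩ := Ideal.Quotient.mk_surjective y
    rw [← map_mul, quot_star_mk, quot_star_mk, quot_star_mk, star_mul, map_mul]
  star_add x y := by
    obtain ⟨a, rfl⟩ := Ideal.Quotient.mk_surjective x
    obtain ⟨b, rfl⟩ := Ideal.Quotient.mk_surjective y
    rw [← map_add, quot_star_mk, quot_star_mk, quot_star_mk, star_add, map_add]

/-- The quotient of a unital C*-algebra by a closed two-sided ideal is a C*-algebra, with the
quotient norm. -/
instance quotientCStarAlgebra : CStarAlgebra (A ⧸ I) where
  toCompleteSpace := Submodule.Quotient.completeSpace I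
  norm_mul_self_le x := by
    obtain ⟨a, rfl⟩ := Ideal.Quotient.mk_surjective x
    refine le_of_forall_pos_lt_add fun ε hε => ?_
    rw [quot_star_mk, ← map_mul]
    obtain ⟨b, hb, hb'⟩ := quot_exists_lt I (Ideal.Quotient.mk I (star a * a)) (half_pos hε)
    have hi : star a * a - b ∈ I := by
      rw [← Ideal.Quotient.eq_zero_iff_mem, map_sub, hb, sub_self]
    obtain ⟨v, hv, hsa, hv1, hv2⟩ := exists_approx_unit I hi (half_pos hε)
    have h1 : Ideal.Quotient.mk I a = Ideal.Quotient.mk I (a * v) := by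
      rw [← sub_eq_zero, ← map_sub, Ideal.Quotient.eq_zero_iff_mem]
      have : a - a * v = a * (1 - v) := by noncomm_ring
      rw [this]
      exact I.mul_mem_left _ hv
    have h2 : ‖a * v‖ * ‖a * v‖ = ‖v * (b * v) + v * ((star a * a - b) * v)‖ := by
      rw [← CStarRing.norm_star_mul_self, star_mul, hsa.star_eq]
      congr 1
      noncomm_ring
    have h3 : ∀ y : A, ‖v * y‖ ≤ ‖y‖ := fun y =>
      (norm_mul_le _ _).trans (mul_le_of_le_one_left (norm_nonneg _) hv1)
    have h4 : ‖b * v‖ ≤ ‖b‖ :=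
      (norm_mul_le _ _).trans (mul_le_of_le_one_right (norm_nonneg _) hv1)
    have h5 := norm_add_le (v * (b * v)) (v * ((star a * a - b) * v))
    have h6 := h3 (b * v)
    have h7 := h3 ((star a * a - b) * v)
    have h8 : ‖Ideal.Quotient.mk I a‖ ≤ ‖a * v‖ := by
      rw [h1]; exact quot_norm_mk_le I _
    have h9 := mul_le_mul h8 h8 (norm_nonneg _) (norm_nonneg _)
    linarith
  star_smul c x := by
    obtain ⟨a, rfl⟩ := Ideal.Quotient.mk_surjective x
    change star (Ideal.Quotient.mk I (c • a)) = star c • star (Ideal.Quotient.mk I a)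
    rw [quot_star_mk, quot_star_mk, star_smul]
    rfl

/-- The quotient map, as a `*`-homomorphism. -/
def quotientMap : A →⋆ₐ[ℂ] A ⧸ I :=
  { Ideal.Quotient.mkₐ ℂ I with
    map_star' := fun _ => rfl }

theorem quotientMap_apply (a : A) : quotientMap I a = Ideal.Quotient.mk I a := rfl

end Quotient

/-! ### Compact quantum groups, quantum subgroups, closed coideals -/

section Quantum

variable {A : Type u} [CStarAlgebra A]

/-- `(A, Δ)` is a separable compact quantum group in the sense of Woronowicz: the unital C*-algebra
`A` is separable, `(Δ ⊗ ι) ∘ Δ = (ι ⊗ Δ) ∘ Δ`, and the sets `{(b ⊗ 1) Δ(c)}` and `{(1 ⊗ b) Δ(c)}`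
span dense subspaces of `A ⊗ A`. -/
structure IsCompactQuantumGroup (Δ : A →⋆ₐ[ℂ] SpatialTensor A A) : Prop where
  separable : TopologicalSpace.SeparableSpace A
  coassoc : ∀ a : A, mapLeft₃ (C := A) Δ (Δ a) = mapRight₃ (A := A) Δ (Δ a)
  dense_left : Dense
    (Submodule.span ℂ {x : SpatialTensor A A | ∃ b c : A, x = stmul b 1 * Δ c} :
      Set (SpatialTensor A A))
  dense_right : Dense
    (Submodule.span ℂ {x : SpatialTensor A A | ∃ b c : A, x = stmul 1 b * Δ c} :
      Set (SpatialTensor A A))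

/-- `(A', Δ')` is a compact quantum subgroup of `(A, Δ)` through `π`: the unital
`*`-homomorphism `π` is surjective and `(π ⊗ π) ∘ Δ = Δ' ∘ π`. -/
structure IsCompactQuantumSubgroup {A' : Type u} [CStarAlgebra A']
    (Δ : A →⋆ₐ[ℂ] SpatialTensor A A) (π : A →⋆ₐ[ℂ] A')
    (Δ' : A' →⋆ₐ[ℂ] SpatialTensor A' A') : Prop where
  surjective : Function.Surjective π
  intertwines : ∀ a : A, SpatialTensor.map π π (Δ a) = Δ' (π a)

/-- The closed subspace `I ⊗ A` of the spatial tensor product `A ⊗ A`. -/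
def idealTensorLeft (I : Ideal A) : Submodule ℂ (SpatialTensor A A) :=
  (Submodule.span ℂ {x | ∃ i ∈ I, ∃ a : A, x = stmul i a}).topologicalClosure

/-- The closed subspace `A ⊗ I` of the spatial tensor product `A ⊗ A`. -/
def idealTensorRight (I : Ideal A) : Submodule ℂ (SpatialTensor A A) :=
  (Submodule.span ℂ {x | ∃ a : A, ∃ i ∈ I, x = stmul a i}).topologicalClosure

/-- The coideal condition `Δ(I) ⊆ I ⊗ A + A ⊗ I`. -/
def IsClosedCoideal (Δ : A →⋆ₐ[ℂ] SpatialTensor A A) (I : Ideal A) : Prop :=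
  ∀ x ∈ I, Δ x ∈ idealTensorLeft I ⊔ idealTensorRight I

/-- The kernel of a unital `*`-homomorphism of C*-algebras, as a two-sided ideal. -/
def kerIdeal {A' : Type u} [CStarAlgebra A'] (π : A →⋆ₐ[ℂ] A') : Ideal A := RingHom.ker π

instance {A' : Type u} [CStarAlgebra A'] (π : A →⋆ₐ[ℂ] A') : (kerIdeal π).IsTwoSided :=
  inferInstanceAs (RingHom.ker π).IsTwoSided

instance {A' : Type u} [CStarAlgebra A'] (π : A →⋆ₐ[ℂ] A') :
    IsClosed (kerIdeal π : Set A) :=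
  isClosed_singleton.preimage (continuous_starAlgHom π) (t := {0})

end Quantum

/-! ### Nuclearity -/

/-- The seminorm `p` on the `*`-algebra `X` is a C*-norm. -/
structure IsCStarNorm {X : Type u} [NonUnitalRing X] [StarRing X] [Module ℂ X]
    (p : Seminorm ℂ X) : Prop where
  mul_le : ∀ x y : X, p (x * y) ≤ p x * p y
  star_mul_self : ∀ x : X, p (star x * x) = p x ^ 2
  eq_zero : ∀ x : X, p x = 0 → x = 0

/-- A C*-algebra `A` is nuclear if, for every C*-algebra `B`, there is only one C*-norm on the
algebraic tensor product of `A` and `B`. -/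
def IsNuclear (A : Type u) [CStarAlgebra A] : Prop :=
  ∀ (B : Type u) [NonUnitalCStarAlgebra B] (p q : Seminorm ℂ (A ⊗[ℂ] B)),
    IsCStarNorm p → IsCStarNorm q → p = q

end CompactQuantum

end

/-!
The ideal `I ⊗ A + A ⊗ I` lies in the kernel of `q ⊗ q`, so for a closed coideal `I` the map
`(q ⊗ q) ∘ Δ` vanishes on `I` and factors through `A ⧸ I`
(`CompactQuantum.exists_quotient_coproduct`). The factorization is unique since `q` is surjective,
and the axioms of a compact quantum group pass to every quantum subgroup: `π ⊗ π ⊗ π` intertwines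
the two sides of coassociativity, and `π ⊗ π` has dense range, so that it carries dense spans to
dense spans (`CompactQuantum.IsCompactQuantumSubgroup.isCompactQuantumGroup`).

For the converse, the coproduct maps `ker π` into the kernel of `π ⊗ π`, so the point is that
`ker (π ⊗ π) = J`, where `J = ker π ⊗ A + A ⊗ ker π`, if `A'` is nuclear. The sum `J` of two closed
ideals is a closed ideal (`CompactQuantum.isClosed_ideal_sup`), so `(A ⊗ A) ⧸ J` is a C*-algebra,
and `π a ⊗ π b ↦ [a ⊗ b]` is a well defined `*`-homomorphism `φ` on the algebraic tensor product
`A' ⊙ A'`. Since `π ⊗ π` factors through `(A ⊗ A) ⧸ J`, the seminorm `x ↦ ‖φ x‖` dominates the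
spatial norm, which is definite because vector functionals of Hilbert space representations
separate the points of `A' ⊙ A'` (`CompactQuantum.eq_zero_of_spatialNorm_eq_zero`). Hence it is a
C*-norm, and nuclearity makes it equal to the spatial norm. So `(A ⊗ A) ⧸ J` embeds isometrically
into `A' ⊗ A'` (`CompactQuantum.norm_quotientMap_tensorIdeal`).
-/

noncomputable section

namespace CompactQuantum

/-! ### Representations separate points -/

section Separation

variable {A : Type u} [CStarAlgebra A]

open scoped ComplexOrder in
/-- Positive functionals separate points: `-b⋆b` lies outside the closed cone of positive elements,
so a real functional that is nonnegative on the cone is positive at `b⋆b`; it is then extended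
complex linearly from the self-adjoint part. -/
theorem exists_positive_apply_ne_zero [PartialOrder A] [StarOrderedRing A] {b : A} (hb : b ≠ 0) :
    ∃ f : A →ₚ[ℂ] ℂ, f (star b * b) ≠ 0 := by
  have hb' : -(star b * b) ∉ ProperCone.positive ℝ A := by
    intro h
    rw [ProperCone.mem_positive] at h
    have h1 : star b * b = 0 := le_antisymm (neg_nonneg.mp h) (star_mul_self_nonneg b)
    exact hb (CStarRing.star_mul_self_eq_zero_iff b |>.mp h1)
  obtain ⟨g, hg, hgb⟩ := ProperCone.hyperplane_separation_point _ hb'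
  let G : Module.Dual ℝ A :=
    (g : A →ₗ[ℝ] ℝ) ∘ₗ (selfAdjoint.submodule ℝ A).subtype ∘ₗ (realPart : A →ₗ[ℝ] selfAdjoint A)
  let F : A →ₗ[ℂ] ℂ := Module.Dual.extendRCLike G
  have hF : ∀ a : A, IsSelfAdjoint a → F a = (g a : ℂ) := by
    intro a ha
    have h1 : G a = g a := congrArg g ha.coe_realPart
    have h2 : G ((Complex.I : ℂ) • a) = 0 := by
      change g ((realPart (Complex.I • a) : selfAdjoint A) : A) = 0
      rw [realPart_I_smul, ha.imaginaryPart, neg_zero, ZeroMemClass.coe_zero, map_zero]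
    have h3 := Module.Dual.extendRCLike_apply (𝕜 := ℂ) G a
    change F a = _ at h3
    rw [h3]
    change ((G a : ℝ) : ℂ) - Complex.I * ((G (Complex.I • a) : ℝ) : ℂ) = _
    rw [h1, h2, Complex.ofReal_zero, mul_zero, sub_zero]
  refine ⟨PositiveLinearMap.mk₀ F fun x hx => ?_, ?_⟩
  · rw [hF x (IsSelfAdjoint.of_nonneg hx)]
    exact Complex.zero_le_real.mpr (hg x hx)
  · change F (star b * b) ≠ 0
    rw [hF _ (IsSelfAdjoint.star_mul_self b), Complex.ofReal_ne_zero]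
    rw [map_neg, neg_lt_zero] at hgb
    exact hgb.ne'

/-- Hilbert space representations separate the points of a C*-algebra. -/
theorem exists_hilbertRep_apply_ne_zero {b : A} (hb : b ≠ 0) :
    ∃ π : HilbertRep A, π.rep b ≠ 0 := by
  let _ := CStarAlgebra.spectralOrder A
  have := CStarAlgebra.spectralOrderedRing A
  obtain ⟨f, hf⟩ := exists_positive_apply_ne_zero hb
  refine ⟨{ space := f.GNS, rep := f.gnsStarAlgHom }, fun h => hf ?_⟩
  have h1 : f.gnsStarAlgHom b = 0 := h
  have h2 : f.gnsStarAlgHom b ((f.toPreGNS 1 : f.PreGNS) : f.GNS) =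
      ((f.toPreGNS b : f.PreGNS) : f.GNS) := by
    rw [PositiveLinearMap.gnsStarAlgHom_apply]
    refine (PositiveLinearMap.gnsNonUnitalStarAlgHom_apply_coe f).trans ?_
    rw [PositiveLinearMap.leftMulMapPreGNS_apply, PositiveLinearMap.ofPreGNS_toPreGNS]
    simp
  rw [h1, zero_apply] at h2
  have h3 : ‖f.toPreGNS b‖ = 0 := by
    rw [← Completion.norm_coe, ← h2, norm_zero]
  have h4 := f.preGNS_norm_sq (f.toPreGNS b)
  rw [h3, PositiveLinearMap.ofPreGNS_toPreGNS] at h4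
  rw [← h4]
  simp

end Separation

/-! ### The spatial norm is definite on the algebraic tensor product -/

section Definite

variable {A B : Type u} [CStarAlgebra A] [CStarAlgebra B]

/-- The slice map `a ⊗ b ↦ φ a • b` on the algebraic tensor product. -/
def slice (φ : A →ₗ[ℂ] ℂ) : A ⊗[ℂ] B →ₗ[ℂ] B :=
  TensorProduct.lift ((LinearMap.lsmul ℂ B : ℂ →ₗ[ℂ] B →ₗ[ℂ] B).comp φ)

theorem slice_tmul (φ : A →ₗ[ℂ] ℂ) (a : A) (b : B) : slice φ (a ⊗ₜ[ℂ] b) = φ a • b := rfl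

/-- The vector functional `a ↦ ⟪ξ', π(a) ξ⟫`. -/
def vectorFunctional (π : HilbertRep A) (ξ ξ' : π.space) : A →ₗ[ℂ] ℂ where
  toFun a := inner ℂ ξ' ((π.rep a).toCLM ξ)
  map_add' a b := by rw [map_add, BddOp.add_toCLM, inner_add_right]
  map_smul' c a := by
    rw [map_smul]
    exact inner_smul_right ξ' ((π.rep a).toCLM ξ) c

/-- Vector functionals separate the points of the algebraic tensor product: if `x = ∑ aᵢ ⊗ bᵢ` with
linearly independent `bᵢ` and `aₖ ≠ 0`, any `φ` with `φ aₖ ≠ 0` has nonzero slice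
`∑ φ(aᵢ) bᵢ`. -/
theorem exists_slice_ne_zero {x : A ⊗[ℂ] B} (hx : x ≠ 0) :
    ∃ (π : HilbertRep A) (ξ ξ' : π.space), slice (vectorFunctional π ξ ξ') x ≠ 0 := by
  let β := Module.Basis.ofVectorSpace ℂ B
  obtain ⟨c, rfl⟩ := TensorProduct.eq_repr_basis_right β x
  have hc : c ≠ 0 := by
    rintro rfl
    exact hx Finsupp.sum_zero_index
  obtain ⟨k, hk⟩ := Finsupp.ne_iff.mp hc
  obtain ⟨π, hπ⟩ := exists_hilbertRep_apply_ne_zero hk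
  have h1 : ∃ ξ, (π.rep (c k)).toCLM ξ ≠ 0 := by
    by_contra! h
    exact hπ (ContinuousLinearMap.ext (f := (π.rep (c k)).toCLM) (g := 0) h)
  obtain ⟨ξ, hξ⟩ := h1
  refine ⟨π, ξ, (π.rep (c k)).toCLM ξ, fun h => ?_⟩
  have h2 := congrArg (fun y => β.repr y k) h
  simp only [Finsupp.sum, map_sum, slice_tmul, map_smul, Module.Basis.repr_self, map_zero,
    Finsupp.coe_finsetSum, Finset.sum_apply, Finsupp.smul_apply, smul_eq_mul, Finsupp.coe_zero,
    Pi.zero_apply] at h2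
  rw [Finset.sum_eq_single k, Finsupp.single_eq_same, mul_one] at h2
  · exact hξ (inner_self_eq_zero.mp h2)
  · intro i _ hi
    rw [Finsupp.single_eq_of_ne hi.symm, mul_zero]
  · intro hk'
    exact absurd (Finsupp.notMem_support_iff.mp hk') hk

/-- The matrix coefficients of `π ⊗ ρ` at elementary tensors are matrix coefficients of `ρ` at
slices. -/
theorem inner_tensorRep_apply (π : HilbertRep A) (ρ : HilbertRep B) (x : A ⊗[ℂ] B)
    (ξ ξ' : π.space) (η η' : ρ.space) :
    inner ℂ (htmul ξ' η') ((tensorRep π.rep ρ.rep x).toCLM (htmul ξ η)) =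
      inner ℂ η' ((ρ.rep (slice (vectorFunctional π ξ ξ') x)).toCLM η) := by
  induction x using TensorProduct.induction_on with
  | zero =>
    rw [map_zero, map_zero, map_zero, BddOp.zero_toCLM, BddOp.zero_toCLM, inner_zero_right,
      inner_zero_right]
  | tmul a b =>
    rw [tensorRep_tmul_apply, inner_htmul, slice_tmul, map_smul]
    exact (inner_smul_right η' ((ρ.rep b).toCLM η) _).symm
  | add x y hx hy =>
    rw [map_add, map_add, map_add, BddOp.add_toCLM, BddOp.add_toCLM, inner_add_right,
      inner_add_right, hx, hy]

/-- The spatial seminorm is a norm on the algebraic tensor product. -/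
theorem eq_zero_of_spatialNorm_eq_zero {x : A ⊗[ℂ] B} (hx : (spatialNorm A B).toSeminorm x = 0) :
    x = 0 := by
  by_contra hne
  obtain ⟨π, ξ, ξ', h⟩ := exists_slice_ne_zero hne
  obtain ⟨ρ, hρ⟩ := exists_hilbertRep_apply_ne_zero h
  refine hρ (ContinuousLinearMap.ext
    (f := (ρ.rep (slice (vectorFunctional π ξ ξ') x)).toCLM) (g := 0) fun η => ?_)
  have h0 : tensorRep π.rep ρ.rep x = 0 :=
    norm_le_zero_iff.mp ((norm_tensorRep_le π.rep ρ.rep x).trans hx.le)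
  rw [zero_apply, ← inner_self_eq_zero (𝕜 := ℂ), ← inner_tensorRep_apply, h0,
    BddOp.zero_toCLM, inner_zero_right]

theorem norm_ofAlg (x : A ⊗[ℂ] B) : ‖ofAlg A B x‖ = (spatialNorm A B).toSeminorm x :=
  (spatialNorm A B).norm_ι x

end Definite

/-! ### Sums of closed ideals -/

section IdealSum

variable {D : Type u} [CStarAlgebra D]

/-- An element of a sum of two ideals has a decomposition whose terms are controlled by its norm:
for `x = i + j` and a contraction `v` with `1 - v ∈ I` and `i * v` small,
`x = (x - j * v) + j * v` is such a decomposition, since `j * v = x * v - i * v`. -/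
theorem exists_controlled_decomposition (I J : Ideal D) [I.IsTwoSided] [J.IsTwoSided] {x : D}
    (hx : x ∈ I ⊔ J) : ∃ i ∈ I, ∃ j ∈ J, i + j = x ∧ ‖i‖ ≤ 3 * ‖x‖ ∧ ‖j‖ ≤ 3 * ‖x‖ := by
  rcases eq_or_ne x 0 with rfl | hne
  · exact ⟨0, I.zero_mem, 0, J.zero_mem, by simp⟩
  obtain ⟨i, hi, j, hj, rfl⟩ := Submodule.mem_sup.mp hx
  obtain ⟨v, hv, -, hv1, hiv⟩ := exists_approx_unit I hi (norm_pos_iff.mpr hne)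
  have h1 : j * v = (i + j) * v - i * v := by noncomm_ring
  have h2 : ‖(i + j) * v‖ ≤ ‖i + j‖ :=
    (norm_mul_le _ _).trans (mul_le_of_le_one_right (norm_nonneg _) hv1)
  have h3 : ‖j * v‖ ≤ 2 * ‖i + j‖ := by
    rw [h1]
    linarith [norm_sub_le ((i + j) * v) (i * v)]
  refine ⟨i + j - j * v, ?_, j * v, J.mul_mem_right _ hj, sub_add_cancel _ _, ?_, ?_⟩
  · have h4 : i + j - j * v = i + j * (1 - v) := by noncomm_ring
    rw [h4]
    exact I.add_mem hi (I.mul_mem_left _ hv)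
  · linarith [norm_sub_le (i + j) (j * v)]
  · linarith [norm_nonneg (i + j)]

/-- The sum of two closed two-sided ideals of a C*-algebra is closed: controlled decompositions
pass to limits. -/
theorem isClosed_ideal_sup (I J : Ideal D) [I.IsTwoSided] [J.IsTwoSided]
    (hI : IsClosed (I : Set D)) (hJ : IsClosed (J : Set D)) :
    IsClosed ((I ⊔ J : Ideal D) : Set D) := by
  have : CompleteSpace I := hI.completeSpace_coe
  have : CompleteSpace J := hJ.completeSpace_coe
  let f : NormedAddGroupHom (I × J) D :=
    AddMonoidHom.mkNormedAddGroupHom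
      (AddMonoidHom.coprod (I.subtype : I →+ D) (J.subtype : J →+ D)) 2 fun p => by
        change ‖(p.1 : D) + (p.2 : D)‖ ≤ 2 * ‖p‖
        have h1 : ‖(p.1 : D)‖ ≤ ‖p‖ := norm_fst_le p
        have h2 : ‖(p.2 : D)‖ ≤ ‖p‖ := norm_snd_le p
        linarith [norm_add_le (p.1 : D) (p.2 : D)]
  have hf : f.SurjectiveOnWith (I ⊔ J : Ideal D).toAddSubgroup 3 := by
    intro x hx
    obtain ⟨i, hi, j, hj, h, h1, h2⟩ := exists_controlled_decomposition I J hx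
    exact ⟨(⟨i, hi⟩, ⟨j, hj⟩), h, max_le h1 h2⟩
  refine isClosed_of_closure_subset fun x hx => ?_
  obtain ⟨p, rfl, -⟩ := controlled_closure_of_complete three_pos one_pos hf x hx
  exact (I ⊔ J).add_mem (Ideal.mem_sup_left p.1.2) (Ideal.mem_sup_right p.2.2)

end IdealSum

/-! ### The ideal `I ⊗ A + A ⊗ I` -/

section TensorIdeal

variable {A : Type u} [CStarAlgebra A]

/-- A closed linear span in the spatial tensor product whose generators are mapped into the span by
left multiplication with elementary tensors is invariant under all left multiplications. -/
theorem mul_mem_topologicalClosure_span {S : Set (SpatialTensor A A)}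
    (hS : ∀ a b, ∀ x ∈ S, stmul a b * x ∈ Submodule.span ℂ S) (w x : SpatialTensor A A)
    (hx : x ∈ (Submodule.span ℂ S).topologicalClosure) :
    w * x ∈ (Submodule.span ℂ S).topologicalClosure := by
  have h1 : ∀ a b, ∀ x ∈ (Submodule.span ℂ S).topologicalClosure,
      stmul a b * x ∈ (Submodule.span ℂ S).topologicalClosure := by
    intro a b x hx
    have h2 : Submodule.span ℂ S ≤ (Submodule.span ℂ S).comap (LinearMap.mulLeft ℂ (stmul a b)) :=
      Submodule.span_le.mpr fun x hx => hS a b x hx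
    exact map_mem_closure (continuous_const_mul (stmul a b)) hx h2
  refine (denseRange_ofAlg A A).induction_on
    (p := fun w => w * x ∈ (Submodule.span ℂ S).topologicalClosure) w
    ((Submodule.isClosed_topologicalClosure _).preimage (continuous_mul_const x)) fun v => ?_
  induction v using TensorProduct.induction_on with
  | zero => rw [map_zero, zero_mul]; exact Submodule.zero_mem _
  | tmul a b => exact h1 a b x hx
  | add v w hv hw => rw [map_add, add_mul]; exact Submodule.add_mem _ hv hw

/-- The right-handed version of `mul_mem_topologicalClosure_span`. -/
theorem mul_mem_topologicalClosure_span' {S : Set (SpatialTensor A A)}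
    (hS : ∀ a b, ∀ x ∈ S, x * stmul a b ∈ Submodule.span ℂ S) (w x : SpatialTensor A A)
    (hx : x ∈ (Submodule.span ℂ S).topologicalClosure) :
    x * w ∈ (Submodule.span ℂ S).topologicalClosure := by
  have h1 : ∀ a b, ∀ x ∈ (Submodule.span ℂ S).topologicalClosure,
      x * stmul a b ∈ (Submodule.span ℂ S).topologicalClosure := by
    intro a b x hx
    have h2 : Submodule.span ℂ S ≤ (Submodule.span ℂ S).comap (LinearMap.mulRight ℂ (stmul a b)) :=
      Submodule.span_le.mpr fun x hx => hS a b x hx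
    exact map_mem_closure (f := fun y => y * stmul a b) (continuous_mul_const _) hx h2
  refine (denseRange_ofAlg A A).induction_on
    (p := fun w => x * w ∈ (Submodule.span ℂ S).topologicalClosure) w
    ((Submodule.isClosed_topologicalClosure _).preimage (continuous_const_mul x)) fun v => ?_
  induction v using TensorProduct.induction_on with
  | zero => rw [map_zero, mul_zero]; exact Submodule.zero_mem _
  | tmul a b => exact h1 a b x hx
  | add v w hv hw => rw [map_add, mul_add]; exact Submodule.add_mem _ hv hw

/-- `I ⊗ A + A ⊗ I` lies in the kernel of `π ⊗ π` if `I` lies in the kernel of `π`. -/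
theorem map_eq_zero_of_mem (I : Ideal A) {A' : Type u} [CStarAlgebra A'] (π : A →⋆ₐ[ℂ] A')
    (hπ : ∀ i ∈ I, π i = 0) {x : SpatialTensor A A}
    (hx : x ∈ idealTensorLeft I ⊔ idealTensorRight I) : SpatialTensor.map π π x = 0 := by
  let T : SpatialTensor A A →ₗ[ℂ] SpatialTensor A' A' :=
    ((SpatialTensor.map π π : SpatialTensor A A →ₐ[ℂ] SpatialTensor A' A') : _ →ₗ[ℂ] _)
  have hT : IsClosed (LinearMap.ker T : Set (SpatialTensor A A)) :=
    isClosed_singleton.preimage (continuous_starAlgHom (SpatialTensor.map π π)) (t := {0})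
  have h0 : ∀ a b : A, π a = 0 ∨ π b = 0 → stmul a b ∈ LinearMap.ker T := by
    intro a b h
    change SpatialTensor.map π π (stmul a b) = 0
    rw [SpatialTensor.map_stmul, stmul]
    rcases h with h | h
    · rw [h, TensorProduct.zero_tmul, map_zero]
    · rw [h, TensorProduct.tmul_zero, map_zero]
  have h1 : idealTensorLeft I ⊔ idealTensorRight I ≤ LinearMap.ker T := by
    refine sup_le (Submodule.topologicalClosure_minimal _ (Submodule.span_le.mpr ?_) hT)
      (Submodule.topologicalClosure_minimal _ (Submodule.span_le.mpr ?_) hT)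
    · rintro _ ⟨i, hi, a, rfl⟩
      exact h0 i a (Or.inl (hπ i hi))
    · rintro _ ⟨a, i, hi, rfl⟩
      exact h0 a i (Or.inr (hπ i hi))
  exact h1 hx

variable (I : Ideal A) [I.IsTwoSided]

/-- The closed subspace `I ⊗ A` as an ideal of `A ⊗ A`. -/
def leftTensorIdeal : Ideal (SpatialTensor A A) :=
  { (idealTensorLeft I).toAddSubmonoid with
    smul_mem' := fun w x hx => mul_mem_topologicalClosure_span (by
      rintro a b _ ⟨i, hi, c, rfl⟩
      rw [stmul_mul_stmul]
      exact Submodule.subset_span ⟨_, I.mul_mem_left a hi, _, rfl⟩) w x hx }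

/-- The closed subspace `A ⊗ I` as an ideal of `A ⊗ A`. -/
def rightTensorIdeal : Ideal (SpatialTensor A A) :=
  { (idealTensorRight I).toAddSubmonoid with
    smul_mem' := fun w x hx => mul_mem_topologicalClosure_span (by
      rintro a b _ ⟨c, i, hi, rfl⟩
      rw [stmul_mul_stmul]
      exact Submodule.subset_span ⟨_, _, I.mul_mem_left b hi, rfl⟩) w x hx }

instance : (leftTensorIdeal I).IsTwoSided where
  mul_mem_of_left {x} w hx := mul_mem_topologicalClosure_span' (by
      rintro a b _ ⟨i, hi, c, rfl⟩
      rw [stmul_mul_stmul]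
      exact Submodule.subset_span ⟨_, I.mul_mem_right a hi, _, rfl⟩) w x hx

instance : (rightTensorIdeal I).IsTwoSided where
  mul_mem_of_left {x} w hx := mul_mem_topologicalClosure_span' (by
      rintro a b _ ⟨c, i, hi, rfl⟩
      rw [stmul_mul_stmul]
      exact Submodule.subset_span ⟨_, _, I.mul_mem_right b hi, rfl⟩) w x hx

/-- The ideal `I ⊗ A + A ⊗ I` of `A ⊗ A`. -/
def tensorIdeal : Ideal (SpatialTensor A A) := leftTensorIdeal I ⊔ rightTensorIdeal I

instance : (tensorIdeal I).IsTwoSided where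
  mul_mem_of_left {x} w hx := by
    obtain ⟨y, hy, z, hz, rfl⟩ := Submodule.mem_sup.mp hx
    rw [add_mul]
    exact Submodule.add_mem_sup (Ideal.mul_mem_right w _ hy) (Ideal.mul_mem_right w _ hz)

instance : IsClosed (tensorIdeal I : Set (SpatialTensor A A)) :=
  isClosed_ideal_sup _ _ (Submodule.isClosed_topologicalClosure _)
    (Submodule.isClosed_topologicalClosure _)

theorem mem_tensorIdeal {x : SpatialTensor A A} :
    x ∈ tensorIdeal I ↔ x ∈ idealTensorLeft I ⊔ idealTensorRight I := by
  rw [tensorIdeal, Submodule.mem_sup, Submodule.mem_sup]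
  rfl

theorem stmul_mem_tensorIdeal_left {i : A} (hi : i ∈ I) (a : A) : stmul i a ∈ tensorIdeal I :=
  Ideal.mem_sup_left (Submodule.le_topologicalClosure _ (Submodule.subset_span ⟨i, hi, a, rfl⟩))

theorem stmul_mem_tensorIdeal_right (a : A) {i : A} (hi : i ∈ I) : stmul a i ∈ tensorIdeal I :=
  Ideal.mem_sup_right (Submodule.le_topologicalClosure _ (Submodule.subset_span ⟨a, i, hi, rfl⟩))

end TensorIdeal

/-! ### Factorization through a surjection -/

section Factor

variable {A A' D : Type u} [CStarAlgebra A] [CStarAlgebra A'] [CStarAlgebra D]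

/-- A `*`-homomorphism that vanishes on the kernel of a surjective one factors through it. -/
theorem exists_factor (π : A →⋆ₐ[ℂ] A') (hπ : Function.Surjective π) (g : A →⋆ₐ[ℂ] D)
    (h : ∀ a, π a = 0 → g a = 0) : ∃ f : A' →⋆ₐ[ℂ] D, ∀ a, f (π a) = g a := by
  have key : ∀ a b, π a = π b → g a = g b := fun a b hab => by
    rw [← sub_eq_zero, ← map_sub]
    exact h _ (by rw [map_sub, hab, sub_self])
  have hs : ∀ a, g (Function.surjInv hπ (π a)) = g a := fun a =>
    key _ _ (Function.surjInv_eq hπ (π a))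
  refine ⟨{ toFun := fun x => g (Function.surjInv hπ x)
            map_one' := by rw [← map_one π, hs, map_one]
            map_mul' := fun x y => ?_
            map_zero' := by rw [← map_zero π, hs, map_zero]
            map_add' := fun x y => ?_
            commutes' := fun c => by
              rw [← AlgHomClass.commutes π, hs, AlgHomClass.commutes]
            map_star' := fun x => ?_ }, hs⟩
  · obtain ⟨a, rfl⟩ := hπ x
    obtain ⟨b, rfl⟩ := hπ y
    rw [← map_mul, hs, hs, hs, map_mul]
  · obtain ⟨a, rfl⟩ := hπ x
    obtain ⟨b, rfl⟩ := hπ y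
    change g (Function.surjInv hπ (π a + π b)) =
      g (Function.surjInv hπ (π a)) + g (Function.surjInv hπ (π b))
    rw [← map_add, hs, hs, hs, map_add]
  · obtain ⟨a, rfl⟩ := hπ x
    rw [← map_star, hs, hs, map_star]

end Factor

/-! ### Functoriality of the threefold spatial tensor product -/

section TripleMap

variable {A B C A' B' C' : Type u} [CStarAlgebra A] [CStarAlgebra B] [CStarAlgebra C]
  [CStarAlgebra A'] [CStarAlgebra B'] [CStarAlgebra C']
  (f : A →⋆ₐ[ℂ] A') (g : B →⋆ₐ[ℂ] B') (h : C →⋆ₐ[ℂ] C')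

/-- The map `a ⊗ b ⊗ c ↦ f a ⊗ g b ⊗ h c` on the algebraic tensor product. -/
def map₃Alg : (A ⊗[ℂ] B) ⊗[ℂ] C →⋆ₐ[ℂ] SpatialTensor₃ A' B' C' :=
  commLift (incl₁₂.comp (mapAlg f g)) (incl₃.comp h) fun x c => incl₁₂_commute (mapAlg f g x) (h c)

theorem map₃Alg_tmul (x : A ⊗[ℂ] B) (c : C) :
    map₃Alg f g h (x ⊗ₜ[ℂ] c) = incl₁₂ (mapAlg f g x) * incl₃ (h c) :=
  commLift_tmul _ _ _ x c

theorem norm_map₃Alg_le (w : (A ⊗[ℂ] B) ⊗[ℂ] C) :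
    ‖map₃Alg f g h w‖ ≤ (spatialNorm₃ A B C).toSeminorm w := by
  refine SpatialTensor₃.norm_le (apply_nonneg _ w) fun π ρ σ => ?_
  have h1 : (SpatialTensor.rep π.rep ρ.rep).comp (mapAlg f g) =
      tensorRep (π.rep.comp f) (ρ.rep.comp g) :=
    tensor_starHom_ext fun a b => by
      rw [StarAlgHom.comp_apply, mapAlg_tmul, stmul, SpatialTensor.rep_ofAlg, tensorRep_tmul,
        tensorRep_tmul, StarAlgHom.comp_apply, StarAlgHom.comp_apply]
  have h2 : (SpatialTensor₃.rep π.rep ρ.rep σ.rep).comp (map₃Alg f g h) =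
      tensorRep (tensorRep (π.rep.comp f) (ρ.rep.comp g)) (σ.rep.comp h) :=
    tensor_starHom_ext fun x c => by
      rw [StarAlgHom.comp_apply, map₃Alg_tmul, map_mul, rep₃_incl₁₂, rep₃_incl₃, tensorRep_tmul,
        ← h1, StarAlgHom.comp_apply, StarAlgHom.comp_apply]
  have h3 := DFunLike.congr_fun h2 w
  rw [StarAlgHom.comp_apply] at h3
  rw [h3]
  exact norm_tensorRep₃_le (π.rep.comp f) (ρ.rep.comp g) (σ.rep.comp h) w

/-- The `*`-homomorphism `f ⊗ g ⊗ h` between threefold spatial tensor products. -/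
def SpatialTensor₃.map : SpatialTensor₃ A B C →⋆ₐ[ℂ] SpatialTensor₃ A' B' C' :=
  (spatialNorm₃ A B C).lift (map₃Alg f g h) (norm_map₃Alg_le f g h)

theorem SpatialTensor₃.map_stmul₃ (a : A) (b : B) (c : C) :
    SpatialTensor₃.map f g h (stmul₃ a b c) = stmul₃ (f a) (g b) (h c) := by
  refine ((spatialNorm₃ A B C).lift_ι _ _ _).trans ?_
  rw [map₃Alg_tmul, mapAlg_tmul, incl₁₂_stmul, incl₃_apply, stmul₃_mul_stmul₃, mul_one, mul_one,
    one_mul]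

theorem SpatialTensor₃.map_incl₁ (a : A) :
    SpatialTensor₃.map f g h (incl₁ a) = incl₁ (f a) := by
  rw [incl₁_apply, map_stmul₃, map_one, map_one, incl₁_apply]

theorem SpatialTensor₃.map_incl₃ (c : C) :
    SpatialTensor₃.map f g h (incl₃ c) = incl₃ (h c) := by
  rw [incl₃_apply, map_stmul₃, map_one, map_one, incl₃_apply]

theorem SpatialTensor₃.map_incl₁₂ (x : SpatialTensor A B) :
    SpatialTensor₃.map f g h (incl₁₂ x) = incl₁₂ (SpatialTensor.map f g x) := by
  have h1 : (SpatialTensor₃.map f g h).comp incl₁₂ = incl₁₂.comp (SpatialTensor.map f g) :=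
    SpatialTensor.hom_ext fun a b => by
      rw [StarAlgHom.comp_apply, StarAlgHom.comp_apply, incl₁₂_stmul, map_stmul₃, map_one,
        SpatialTensor.map_stmul, incl₁₂_stmul]
  exact DFunLike.congr_fun h1 x

theorem SpatialTensor₃.map_incl₂₃ (x : SpatialTensor B C) :
    SpatialTensor₃.map f g h (incl₂₃ x) = incl₂₃ (SpatialTensor.map g h x) := by
  have h1 : (SpatialTensor₃.map f g h).comp incl₂₃ = incl₂₃.comp (SpatialTensor.map g h) :=
    SpatialTensor.hom_ext fun b c => by
      rw [StarAlgHom.comp_apply, StarAlgHom.comp_apply, incl₂₃_stmul, map_stmul₃, map_one,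
        SpatialTensor.map_stmul, incl₂₃_stmul]
  exact DFunLike.congr_fun h1 x

end TripleMap

/-! ### Quantum subgroups and quotient coproducts -/

section Subgroup

variable {A A' : Type u} [CStarAlgebra A] [CStarAlgebra A'] {π : A →⋆ₐ[ℂ] A'}

theorem denseRange_map (hπ : Function.Surjective π) : DenseRange (SpatialTensor.map π π) := by
  refine (denseRange_ofAlg A' A').mono ?_
  rintro _ ⟨v, rfl⟩
  induction v using TensorProduct.induction_on with
  | zero => exact ⟨0, by rw [map_zero, map_zero]⟩
  | tmul x y =>
    obtain ⟨a, rfl⟩ := hπ x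
    obtain ⟨b, rfl⟩ := hπ y
    exact ⟨stmul a b, SpatialTensor.map_stmul π π a b⟩
  | add v w hv hw =>
    obtain ⟨x, hx⟩ := hv
    obtain ⟨y, hy⟩ := hw
    exact ⟨x + y, by rw [map_add, map_add, hx, hy]⟩

theorem dense_span_of_map (hπ : Function.Surjective π) {S : Set (SpatialTensor A A)}
    {S' : Set (SpatialTensor A' A')} (hS : Dense (Submodule.span ℂ S : Set (SpatialTensor A A)))
    (h : ∀ x ∈ S, SpatialTensor.map π π x ∈ S') :
    Dense (Submodule.span ℂ S' : Set (SpatialTensor A' A')) := by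
  refine ((denseRange_map hπ).dense_image
    (continuous_starAlgHom (SpatialTensor.map π π)) hS).mono ?_
  rintro _ ⟨x, hx, rfl⟩
  let T : SpatialTensor A A →ₗ[ℂ] SpatialTensor A' A' :=
    ((SpatialTensor.map π π : SpatialTensor A A →ₐ[ℂ] SpatialTensor A' A') : _ →ₗ[ℂ] _)
  have h1 : Submodule.span ℂ S ≤ (Submodule.span ℂ S').comap T :=
    Submodule.span_le.mpr fun x hx => Submodule.subset_span (h x hx)
  exact h1 hx

/-- A compact quantum subgroup of a separable compact quantum group is itself a separable compact
quantum group: every axiom is transported along the surjection. -/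
theorem IsCompactQuantumSubgroup.isCompactQuantumGroup {Δ : A →⋆ₐ[ℂ] SpatialTensor A A}
    {Δ' : A' →⋆ₐ[ℂ] SpatialTensor A' A'} (h : IsCompactQuantumSubgroup Δ π Δ')
    (hΔ : IsCompactQuantumGroup Δ) : IsCompactQuantumGroup Δ' where
  separable := by
    have := hΔ.separable
    exact h.surjective.denseRange.separableSpace (continuous_starAlgHom π)
  coassoc := by
    have hl : (SpatialTensor₃.map π π π).comp (mapLeft₃ Δ) =
        (mapLeft₃ Δ').comp (SpatialTensor.map π π) :=
      SpatialTensor.hom_ext fun a c => by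
        rw [StarAlgHom.comp_apply, StarAlgHom.comp_apply, mapLeft₃_stmul, map_mul,
          SpatialTensor₃.map_incl₁₂, SpatialTensor₃.map_incl₃, SpatialTensor.map_stmul,
          mapLeft₃_stmul, h.intertwines]
    have hr : (SpatialTensor₃.map π π π).comp (mapRight₃ Δ) =
        (mapRight₃ Δ').comp (SpatialTensor.map π π) :=
      SpatialTensor.hom_ext fun a c => by
        rw [StarAlgHom.comp_apply, StarAlgHom.comp_apply, mapRight₃_stmul, map_mul,
          SpatialTensor₃.map_incl₁, SpatialTensor₃.map_incl₂₃, SpatialTensor.map_stmul,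
          mapRight₃_stmul, h.intertwines]
    intro x
    obtain ⟨a, rfl⟩ := h.surjective x
    have hl' := DFunLike.congr_fun hl (Δ a)
    have hr' := DFunLike.congr_fun hr (Δ a)
    rw [StarAlgHom.comp_apply, StarAlgHom.comp_apply, h.intertwines] at hl' hr'
    rw [← hl', ← hr', hΔ.coassoc]
  dense_left := by
    refine dense_span_of_map h.surjective hΔ.dense_left ?_
    rintro _ ⟨b, c, rfl⟩
    exact ⟨π b, π c, by rw [map_mul, SpatialTensor.map_stmul, map_one, h.intertwines]⟩
  dense_right := by
    refine dense_span_of_map h.surjective hΔ.dense_right ?_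
    rintro _ ⟨b, c, rfl⟩
    exact ⟨π b, π c, by rw [map_mul, SpatialTensor.map_stmul, map_one, h.intertwines]⟩

end Subgroup

section QuotientCoproduct

variable {A : Type u} [CStarAlgebra A] (I : Ideal A) [I.IsTwoSided] [IsClosed (I : Set A)]

theorem quotientMap_surjective : Function.Surjective (quotientMap I) := Ideal.Quotient.mk_surjective

theorem quotientMap_eq_zero_iff {a : A} : quotientMap I a = 0 ↔ a ∈ I :=
  Ideal.Quotient.eq_zero_iff_mem

/-- The coproduct descends to the quotient by a closed coideal. -/
theorem exists_quotient_coproduct {Δ : A →⋆ₐ[ℂ] SpatialTensor A A} (hI : IsClosedCoideal Δ I) :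
    ∃ ΔI : A ⧸ I →⋆ₐ[ℂ] SpatialTensor (A ⧸ I) (A ⧸ I),
      IsCompactQuantumSubgroup Δ (quotientMap I) ΔI := by
  obtain ⟨ΔI, h⟩ := exists_factor (quotientMap I) (quotientMap_surjective I)
    ((SpatialTensor.map (quotientMap I) (quotientMap I)).comp Δ) fun a ha =>
      map_eq_zero_of_mem I (quotientMap I) (fun i hi => (quotientMap_eq_zero_iff I).mpr hi)
        (hI a ((quotientMap_eq_zero_iff I).mp ha))
  exact ⟨ΔI, quotientMap_surjective I, fun a => (h a).symm⟩

end QuotientCoproduct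

/-! ### The kernel of `π ⊗ π` for a nuclear target -/

section Nuclear

variable {A A' : Type u} [CStarAlgebra A] [CStarAlgebra A'] {π : A →⋆ₐ[ℂ] A'}

/-- If `A'` is nuclear, the kernel of `π ⊗ π` is `ker π ⊗ A + A ⊗ ker π`: the quotient of `A ⊗ A`
by the latter induces a C*-norm on the algebraic tensor product of `A'` with itself, which must be
the spatial norm, so that quotient embeds isometrically into `A' ⊗ A'`. -/
theorem norm_quotientMap_tensorIdeal (hπ : Function.Surjective π) (hA' : IsNuclear A')
    (z : SpatialTensor A A) :
    ‖quotientMap (tensorIdeal (kerIdeal π)) z‖ = ‖SpatialTensor.map π π z‖ := by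
  set J := tensorIdeal (kerIdeal π)
  obtain ⟨f, hf⟩ := exists_factor π hπ ((quotientMap J).comp (inclLeft A A)) fun a ha =>
    (quotientMap_eq_zero_iff J).mpr (stmul_mem_tensorIdeal_left (kerIdeal π) ha 1)
  obtain ⟨g, hg⟩ := exists_factor π hπ ((quotientMap J).comp (inclRight A A)) fun a ha =>
    (quotientMap_eq_zero_iff J).mpr (stmul_mem_tensorIdeal_right (kerIdeal π) 1 ha)
  have hfg : ∀ x y, Commute (f x) (g y) := by
    intro x y
    obtain ⟨a, rfl⟩ := hπ x
    obtain ⟨b, rfl⟩ := hπ y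
    rw [hf, hg]
    exact (incl_commute a b).map (quotientMap J)
  let φ : A' ⊗[ℂ] A' →⋆ₐ[ℂ] SpatialTensor A A ⧸ J := commLift f g hfg
  have hφ : ∀ a b, φ (π a ⊗ₜ[ℂ] π b) = quotientMap J (stmul a b) := by
    intro a b
    refine (commLift_tmul f g hfg _ _).trans ?_
    rw [hf, hg, StarAlgHom.comp_apply, StarAlgHom.comp_apply, ← map_mul, inclLeft_apply,
      inclRight_apply, stmul_mul_stmul, mul_one, one_mul]
  -- `Ψ ∘ φ` is the canonical map, so `‖φ x‖` dominates the spatial norm of `x`.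
  obtain ⟨Ψ, hΨ⟩ := exists_factor (quotientMap J) (quotientMap_surjective J)
    (SpatialTensor.map π π) fun z hz => map_eq_zero_of_mem (kerIdeal π) π (fun i hi => hi)
      ((mem_tensorIdeal (kerIdeal π)).mp ((quotientMap_eq_zero_iff J).mp hz))
  have hΨφ : ∀ x, Ψ (φ x) = ofAlg A' A' x := by
    have h : Ψ.comp φ = ofAlg A' A' := tensor_starHom_ext fun x y => by
      obtain ⟨a, rfl⟩ := hπ x
      obtain ⟨b, rfl⟩ := hπ y
      rw [StarAlgHom.comp_apply, hφ, hΨ, SpatialTensor.map_stmul, stmul]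
    exact DFunLike.congr_fun h
  let p : Seminorm ℂ (A' ⊗[ℂ] A') :=
    (normSeminorm ℂ (SpatialTensor A A ⧸ J)).comp (φ : A' ⊗[ℂ] A' →ₐ[ℂ] SpatialTensor A A ⧸ J).toLinearMap
  have hp : ∀ x, p x = ‖φ x‖ := fun x => rfl
  have hpC : IsCStarNorm p :=
    { mul_le := fun x y => by
        rw [hp, hp, hp, map_mul]
        exact norm_mul_le _ _
      star_mul_self := fun x => by
        rw [hp, hp, map_mul, map_star, CStarRing.norm_star_mul_self, sq]
      eq_zero := fun x hx => by
        rw [hp, norm_eq_zero] at hx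
        refine eq_zero_of_spatialNorm_eq_zero ?_
        rw [← norm_ofAlg, ← hΨφ, hx, map_zero, norm_zero] }
  have hsC : IsCStarNorm (spatialNorm A' A').toSeminorm :=
    { mul_le := (spatialNorm A' A').mul_le'
      star_mul_self := (spatialNorm A' A').star_mul_self'
      eq_zero := fun _ => eq_zero_of_spatialNorm_eq_zero }
  have hiso : ∀ x, ‖φ x‖ = ‖ofAlg A' A' x‖ := fun x => by
    rw [norm_ofAlg, ← hp, hA' A' p _ hpC hsC]
  have hrange : ∀ v, ∃ x, φ x = quotientMap J (ofAlg A A v) := by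
    intro v
    induction v using TensorProduct.induction_on with
    | zero => exact ⟨0, by rw [map_zero, map_zero, map_zero]⟩
    | tmul a b => exact ⟨π a ⊗ₜ[ℂ] π b, hφ a b⟩
    | add v w hv hw =>
      obtain ⟨x, hx⟩ := hv
      obtain ⟨y, hy⟩ := hw
      exact ⟨x + y, by rw [map_add, map_add, map_add, hx, hy]⟩
  refine (denseRange_ofAlg A A).induction_on
    (p := fun z => ‖quotientMap J z‖ = ‖SpatialTensor.map π π z‖) z
    (isClosed_eq (continuous_starAlgHom (quotientMap J)).norm
      (continuous_starAlgHom (SpatialTensor.map π π)).norm) fun v => ?_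
  obtain ⟨x, hx⟩ := hrange v
  rw [← hΨ, ← hx, hΨφ, hiso]

theorem isClosedCoideal_kerIdeal {Δ : A →⋆ₐ[ℂ] SpatialTensor A A}
    {Δ' : A' →⋆ₐ[ℂ] SpatialTensor A' A'} (hA' : IsNuclear A')
    (h : IsCompactQuantumSubgroup Δ π Δ') : IsClosedCoideal Δ (kerIdeal π) := by
  intro x hx
  have hx' : π x = 0 := hx
  rw [← mem_tensorIdeal, ← quotientMap_eq_zero_iff, ← norm_eq_zero,
    norm_quotientMap_tensorIdeal h.surjective hA', h.intertwines, hx', map_zero, norm_zero]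

/-- The C*-algebra isomorphism `A ⧸ ker π ≃ A'` that is induced by a surjection `π`. -/
theorem exists_quotient_kerIdeal_equiv (hπ : Function.Surjective π) :
    ∃ e : (A ⧸ kerIdeal π) ≃⋆ₐ[ℂ] A', ∀ a, e (quotientMap (kerIdeal π) a) = π a := by
  obtain ⟨f, hf⟩ := exists_factor (quotientMap (kerIdeal π)) (quotientMap_surjective _) π
    fun a ha => (quotientMap_eq_zero_iff (kerIdeal π)).mp ha
  refine ⟨StarAlgEquiv.ofBijective f ⟨?_, fun y => ?_⟩, hf⟩
  · rw [injective_iff_map_eq_zero]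
    intro x hx
    obtain ⟨a, rfl⟩ := quotientMap_surjective (kerIdeal π) x
    rw [hf] at hx
    exact (quotientMap_eq_zero_iff (kerIdeal π)).mpr hx
  · obtain ⟨a, rfl⟩ := hπ y
    exact ⟨quotientMap (kerIdeal π) a, hf a⟩

end Nuclear

end CompactQuantum

end

theorem mainTheorem7 {A : Type u} [CStarAlgebra A]
    (Δ : A →⋆ₐ[ℂ] CompactQuantum.SpatialTensor A A)
    (hΔ : CompactQuantum.IsCompactQuantumGroup Δ) :
    (∀ (I : Ideal A) [I.IsTwoSided] [IsClosed (I : Set A)],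
      CompactQuantum.IsClosedCoideal Δ I →
        ∃ ΔI : A ⧸ I →⋆ₐ[ℂ] CompactQuantum.SpatialTensor (A ⧸ I) (A ⧸ I),
          CompactQuantum.IsCompactQuantumGroup ΔI ∧
          CompactQuantum.IsCompactQuantumSubgroup Δ (CompactQuantum.quotientMap I) ΔI ∧
          ∀ Δ'' : A ⧸ I →⋆ₐ[ℂ] CompactQuantum.SpatialTensor (A ⧸ I) (A ⧸ I),
            CompactQuantum.IsCompactQuantumSubgroup Δ (CompactQuantum.quotientMap I) Δ'' →
              Δ'' = ΔI) ∧
    (∀ (A' : Type u) [CStarAlgebra A'] (Δ' : A' →⋆ₐ[ℂ] CompactQuantum.SpatialTensor A' A')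
      (π : A →⋆ₐ[ℂ] A'),
      CompactQuantum.IsNuclear A' →
      CompactQuantum.IsCompactQuantumSubgroup Δ π Δ' →
        CompactQuantum.IsClosedCoideal Δ (CompactQuantum.kerIdeal π) ∧
        ∃ ΔI : A ⧸ CompactQuantum.kerIdeal π →⋆ₐ[ℂ]
            CompactQuantum.SpatialTensor (A ⧸ CompactQuantum.kerIdeal π)
              (A ⧸ CompactQuantum.kerIdeal π),
          CompactQuantum.IsCompactQuantumSubgroup Δ
            (CompactQuantum.quotientMap (CompactQuantum.kerIdeal π)) ΔI ∧
          ∃ e : (A ⧸ CompactQuantum.kerIdeal π) ≃⋆ₐ[ℂ] A',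
            (∀ a : A, e (CompactQuantum.quotientMap (CompactQuantum.kerIdeal π) a) = π a) ∧
            ∀ x : A ⧸ CompactQuantum.kerIdeal π,
              CompactQuantum.SpatialTensor.map (e : A ⧸ CompactQuantum.kerIdeal π →⋆ₐ[ℂ] A')
                (e : A ⧸ CompactQuantum.kerIdeal π →⋆ₐ[ℂ] A') (ΔI x) = Δ' (e x)) := by
  open CompactQuantum in
  refine ⟨fun I _ _ hI => ?_, fun A' _ Δ' π hA' h => ?_⟩
  · obtain ⟨ΔI, h⟩ := exists_quotient_coproduct I hI
    refine ⟨ΔI, h.isCompactQuantumGroup hΔ, h, fun Δ'' h'' => ?_⟩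
    ext x
    obtain ⟨a, rfl⟩ := quotientMap_surjective I x
    rw [← h.intertwines, ← h''.intertwines]
  · have hI := isClosedCoideal_kerIdeal hA' h
    obtain ⟨ΔI, hq⟩ := exists_quotient_coproduct (kerIdeal π) hI
    obtain ⟨e, he⟩ := exists_quotient_kerIdeal_equiv h.surjective
    refine ⟨hI, ΔI, hq, e, he, fun x => ?_⟩
    obtain ⟨a, rfl⟩ := quotientMap_surjective (kerIdeal π) x
    -- Both sides are computed from `Δ a`, because `e ∘ q = π`.
    have hmap : (SpatialTensor.map (e : A ⧸ kerIdeal π →⋆ₐ[ℂ] A')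
        (e : A ⧸ kerIdeal π →⋆ₐ[ℂ] A')).comp
        (SpatialTensor.map (quotientMap (kerIdeal π)) (quotientMap (kerIdeal π))) =
        SpatialTensor.map π π :=
      SpatialTensor.hom_ext fun a b => by
        rw [StarAlgHom.comp_apply, SpatialTensor.map_stmul, SpatialTensor.map_stmul,
          SpatialTensor.map_stmul]
        exact congrArg₂ stmul (he a) (he b)
    rw [← hq.intertwines, ← StarAlgHom.comp_apply, hmap, h.intertwines, he]
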